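/- Fix an infinite set $\mathbb D$ of data values. The emptiness problem for alternating one-register tree automata with $\mathsf{guess}$ and $\mathsf{spread}$ is decidable: there is an algorithm that, given (a finite description of) an automaton $\mathcal A\in\mathsf{ATRA}(\mathsf{guess},\mathsf{spread})$, decides whether $\mathcal L(\mathcal A)=\emptyset$. Here the notions are the following. **Data trees.** A data tree $T$ over a finite alphabet $\mathbb A$ is a finite nonempty ordered unranked tree each of whose nodes $x$ carries a pair $T(x)\in\mathbb A\times\mathbb D$. The type of a node records whether it has a child ($\triangledown$ or $\bar\triangledown$) and whether it has a next sibling to its right ($\rhd$ or $\bar\rhd$). **Automata.** An automaton is $\mathcal A=\langle\mathbb A,Q,q_I,\delta\rangle$ with $\mathbb A$, $Q$ finite, $q_I\in Q$, and $\delta$ mapping each state to one of the instructions $$a\mid \bar a\mid \odot?\mid \mathsf{store}(q)\mid \mathsf{eq}\mid\overline{\mathsf{eq}}\mid q\wedge q'\mid q\vee q'\mid \triangledown q\mid \rhd q\mid \mathsf{guess}(q)\mid \mathsf{spread}(q,q')$$ with $a\in\mathbb A$, $q,q'\in Q$, $\odot\in\{\triangledown,\bar\triangledown,\rhd,\bar\rhd\}$.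 The instructions $\triangledown q$ and $\rhd q$ are called moving. **Configurations.** A node configuration is $\langle x,\alpha,(a,d),\Delta\rangle$ with $x$ a position, $\alpha$ a type, $a\in\mathbb A$, $d\in\mathbb D$, and $\Delta\subseteq Q\times\mathbb D$ a finite set of threads (a state and a register value). A tree configuration is a finite set of node configurations. **Non-moving steps** $\to_\varepsilon$. From $\langle x,\alpha,(a,d),\{(q,d')\}\cup\Delta\rangle$ one may go to $\langle x,\alpha,(a,d),N\cup\Delta\rangle$, where: $N=\{(q_1,d')\}$ or $N=\{(q_2,d')\}$ if $\delta(q)=q_1\vee q_2$; $N=\{(q_1,d'),(q_2,d')\}$ if $\delta(q)=q_1\wedge q_2$; $N=\{(q',d)\}$ if $\delta(q)=\mathsf{store}(q')$; $N=\{(q',e)\}$ for any $e\in\mathbb D$ if $\delta(q)=\mathsf{guess}(q')$; $N=\emptyset$ if $\delta(q)$ is a test that holds ($\mathsf{eq}$: $d=d'$; $\overline{\mathsf{eq}}$: $d\ne d'$; $\odot?$: $\odot$ occurs in $\alpha$; $b$: $b=a$; $\bar b$: $b\neq a$); and $N=\{(q_1,e)\mid (q_2,e)\in\Delta\}$ if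 $\delta(q)=\mathsf{spread}(q_2,q_1)$, provided that every thread of $\Delta$ has a $\mathsf{spread}$ or a moving instruction. **Moving steps.** If all threads of $\rho=\langle x,\alpha,\gamma,\Delta\rangle$ are moving, then, when $\alpha$ contains $\triangledown$, $\rho\to_\triangledown\langle y,\alpha_1,\gamma_1,\{(q',d)\mid (q,d)\in\Delta,\ \delta(q)=\triangledown q'\}\rangle$ with $y$ the first-child position of $x$ and $\alpha_1,\gamma_1$ arbitrary, and, when $\alpha$ contains $\rhd$, $\rho\to_\rhd\langle z,\alpha_1,\gamma_1,\{(q',d)\mid (q,d)\in\Delta,\ \delta(q)=\rhd q'\}\rangle$ with $z$ the next-sibling position of $x$. **Runs.** A step of tree configurations goes from $\{\rho\}\cup\mathcal S$ to $\{\tau\}\cup\mathcal S$, where $\rho\to_\varepsilon\tau$, or $\rho$ has type $(\triangledown,\bar\rhd)$ and $\rho\to_\triangledown\tau$, or $\rho$ has type $(\bar\triangledown,\rhd)$ and $\rho\to_\rhd\tau$; or from $\{\rho\}\cup\mathcal S$ to $\{\tau_1,\tau_2\}\cup\mathcal S$, where $\rho$ has type $(\triangledown,\rhd)$, $\rho\to_\triangledown\tau_1$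 and $\rho\to_\rhd\tau_2$. A run over a data tree $T$ is a nonempty finite sequence of tree configurations, each obtained from the previous one by such a step, whose first element consists of one node configuration at the root with the single thread $(q_I,d_0)$, $d_0$ the datum of the root, such that every node configuration $\langle x,\alpha,\gamma,\Delta\rangle$ occurring in it satisfies $x\in\mathrm{pos}(T)$, $\gamma=T(x)$ and $\alpha=\mathrm{type}_T(x)$. It is accepting if in its last tree configuration all node configurations have $\Delta=\emptyset$. $\mathcal L(\mathcal A)$ is the set of data trees over which $\mathcal A$ has an accepting run. -/

import Mathlib

universe u v w

namespace ATRA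

/-! ### Data trees -/

/-- A data tree: a finite, ordered, unranked, nonempty tree whose nodes carry a letter and a datum.
A position is a sequence of indices; the children of `x` are `x ++ [0], x ++ [1], …`
(siblings are numbered from left to right, starting with `0`). -/
structure DataTree (Alph : Type v) (D : Type u) where
  pos : Finset (List ℕ)
  root_mem : [] ∈ pos
  prefix_closed : ∀ x y, x ++ y ∈ pos → x ∈ pos
  sibling_closed : ∀ x i, x ++ [i + 1] ∈ pos → x ++ [i] ∈ pos
  label : {x // x ∈ pos} → Alph × D

/-- A tree type: does the node have a child, does it have a sibling to its right? -/
structure TreeType where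
  child : Bool
  sibling : Bool

/-- `α` is the type of the position `x` in the tree. -/
def DataTree.HasType {Alph : Type v} {D : Type u} (T : DataTree Alph D) (x : List ℕ)
    (α : TreeType) : Prop :=
  (α.child = true ↔ x ++ [0] ∈ T.pos) ∧
  (α.sibling = true ↔ ∃ x' i, x = x' ++ [i] ∧ x' ++ [i + 1] ∈ T.pos)

/-! ### Automata -/

/-- The four tests on the type of the current node. -/
inductive TypeTest
  | child
  | noChild
  | sibling
  | noSibling

/-- The type `α` passes the test. -/
def TypeTest.Holds : TypeTest → TreeType → Prop
  | .child, α => α.child = true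
  | .noChild, α => α.child = false
  | .sibling, α => α.sibling = true
  | .noSibling, α => α.sibling = false

/-- The right-hand sides of the transition function. -/
inductive Instr (Alph : Type v) (Q : Type w)
  | letter (a : Alph)
  | notLetter (a : Alph)
  | test (b : TypeTest)
  | store (q : Q)
  | eq
  | neq
  | and (q q' : Q)
  | or (q q' : Q)
  | down (q : Q)
  | right (q : Q)
  | guess (q : Q)
  | spread (q q' : Q)

/-- The moving instructions: go to the leftmost child, go to the next sibling to the right. -/
def Instr.IsMoving {Alph : Type v} {Q : Type w} (φ : Instr Alph Q) : Prop :=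
  (∃ q, φ = .down q) ∨ (∃ q, φ = .right q)

def Instr.IsSpread {Alph : Type v} {Q : Type w} (φ : Instr Alph Q) : Prop :=
  ∃ q q', φ = .spread q q'

/-- An alternating tree one-register automaton with `guess` and `spread`, with alphabet `Alph` and
set of states `Q`; finiteness of both is required where automata are quantified over. -/
structure Automaton (Alph : Type v) (Q : Type w) where
  init : Q
  δ : Q → Instr Alph Q

/-! ### Configurations and runs -/

/-- A node configuration `⟨x, α, (a, d), Δ⟩`; a thread is a state together with a register value. -/
structure NodeConf (Alph : Type v) (Q : Type w) (D : Type u) where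
  pos : List ℕ
  type : TreeType
  letter : Alph
  datum : D
  threads : Finset (Q × D)

/-- A tree configuration is a finite set of node configurations. -/
abbrev TreeConf (Alph : Type v) (Q : Type w) (D : Type u) := Finset (NodeConf Alph Q D)

section Semantics

variable {Alph : Type v} {Q : Type w} {D : Type u}

/-- `ThreadStep A α a d t N`: at a node of type `α` with letter `a` and datum `d`, the thread `t`
can be replaced by the set of threads `N` (all non-moving instructions except `spread`). -/
inductive ThreadStep (A : Automaton Alph Q) (α : TreeType) (a : Alph) (d : D) :
    Q × D → Set (Q × D) → Prop
  | or_left {q q₁ q₂ : Q} {d' : D} : A.δ q = .or q₁ q₂ → ThreadStep A α a d (q, d') {(q₁, d')}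
  | or_right {q q₁ q₂ : Q} {d' : D} : A.δ q = .or q₁ q₂ → ThreadStep A α a d (q, d') {(q₂, d')}
  | and {q q₁ q₂ : Q} {d' : D} :
      A.δ q = .and q₁ q₂ → ThreadStep A α a d (q, d') {(q₁, d'), (q₂, d')}
  | store {q q' : Q} {d' : D} : A.δ q = .store q' → ThreadStep A α a d (q, d') {(q', d)}
  | eq {q : Q} {d' : D} : A.δ q = .eq → d = d' → ThreadStep A α a d (q, d') ∅
  | neq {q : Q} {d' : D} : A.δ q = .neq → d ≠ d' → ThreadStep A α a d (q, d') ∅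
  | test {q : Q} {d' : D} {b : TypeTest} :
      A.δ q = .test b → b.Holds α → ThreadStep A α a d (q, d') ∅
  | letter {q : Q} {d' : D} {b : Alph} :
      A.δ q = .letter b → b = a → ThreadStep A α a d (q, d') ∅
  | notLetter {q : Q} {d' : D} {b : Alph} :
      A.δ q = .notLetter b → b ≠ a → ThreadStep A α a d (q, d') ∅
  | guess {q q' : Q} {d' : D} (e : D) :
      A.δ q = .guess q' → ThreadStep A α a d (q, d') {(q', e)}

/-- The non-moving relation between node configurations. -/
inductive EpsStep (A : Automaton Alph Q) : NodeConf Alph Q D → NodeConf Alph Q D → Prop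
  | thread {x : List ℕ} {α : TreeType} {a : Alph} {d : D} {Γ Γ' Δ : Finset (Q × D)}
      {t : Q × D} {N : Set (Q × D)} :
      (Γ : Set (Q × D)) = {t} ∪ ↑Δ → ThreadStep A α a d t N → (Γ' : Set (Q × D)) = N ∪ ↑Δ →
      EpsStep A ⟨x, α, a, d, Γ⟩ ⟨x, α, a, d, Γ'⟩
  | spread {x : List ℕ} {α : TreeType} {a : Alph} {d : D} {Γ Γ' Δ : Finset (Q × D)}
      {q q₁ q₂ : Q} {d' : D} :
      (Γ : Set (Q × D)) = {(q, d')} ∪ ↑Δ → A.δ q = .spread q₂ q₁ →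
      (∀ t ∈ Δ, (A.δ t.1).IsSpread ∨ (A.δ t.1).IsMoving) →
      (Γ' : Set (Q × D)) = {t | t.1 = q₁ ∧ (q₂, t.2) ∈ Δ} ∪ ↑Δ →
      EpsStep A ⟨x, α, a, d, Γ⟩ ⟨x, α, a, d, Γ'⟩

/-- A node configuration is moving if all its threads are. -/
def NodeConf.IsMoving (A : Automaton Alph Q) (ρ : NodeConf Alph Q D) : Prop :=
  ∀ t ∈ ρ.threads, (A.δ t.1).IsMoving

/-- The first-child relation between node configurations. -/
def ChildStep (A : Automaton Alph Q) (ρ τ : NodeConf Alph Q D) : Prop :=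
  ρ.type.child = true ∧ τ.pos = ρ.pos ++ [0] ∧ ρ.IsMoving A ∧
  (τ.threads : Set (Q × D)) = {t | ∃ q, (q, t.2) ∈ ρ.threads ∧ A.δ q = .down t.1}

/-- The next-sibling relation between node configurations. -/
def SiblingStep (A : Automaton Alph Q) (ρ τ : NodeConf Alph Q D) : Prop :=
  ρ.type.sibling = true ∧ (∃ x i, ρ.pos = x ++ [i] ∧ τ.pos = x ++ [i + 1]) ∧ ρ.IsMoving A ∧
  (τ.threads : Set (Q × D)) = {t | ∃ q, (q, t.2) ∈ ρ.threads ∧ A.δ q = .right t.1}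

/-- The transition relation between tree configurations. -/
inductive TreeStep (A : Automaton Alph Q) : TreeConf Alph Q D → TreeConf Alph Q D → Prop
  | eps {S₁ S₂ S : TreeConf Alph Q D} {ρ τ : NodeConf Alph Q D} :
      (S₁ : Set (NodeConf Alph Q D)) = {ρ} ∪ ↑S → (S₂ : Set (NodeConf Alph Q D)) = {τ} ∪ ↑S →
      EpsStep A ρ τ → TreeStep A S₁ S₂
  | child {S₁ S₂ S : TreeConf Alph Q D} {ρ τ : NodeConf Alph Q D} :
      (S₁ : Set (NodeConf Alph Q D)) = {ρ} ∪ ↑S → (S₂ : Set (NodeConf Alph Q D)) = {τ} ∪ ↑S →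
      ρ.type = ⟨true, false⟩ → ChildStep A ρ τ → TreeStep A S₁ S₂
  | sibling {S₁ S₂ S : TreeConf Alph Q D} {ρ τ : NodeConf Alph Q D} :
      (S₁ : Set (NodeConf Alph Q D)) = {ρ} ∪ ↑S → (S₂ : Set (NodeConf Alph Q D)) = {τ} ∪ ↑S →
      ρ.type = ⟨false, true⟩ → SiblingStep A ρ τ → TreeStep A S₁ S₂
  | both {S₁ S₂ S : TreeConf Alph Q D} {ρ τ₁ τ₂ : NodeConf Alph Q D} :
      (S₁ : Set (NodeConf Alph Q D)) = {ρ} ∪ ↑S →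
      (S₂ : Set (NodeConf Alph Q D)) = {τ₁, τ₂} ∪ ↑S →
      ρ.type = ⟨true, true⟩ → ChildStep A ρ τ₁ → SiblingStep A ρ τ₂ → TreeStep A S₁ S₂

/-- The node configuration carries the right type, letter and datum for its position in `T`. -/
def NodeConf.IsOver (T : DataTree Alph D) (ρ : NodeConf Alph Q D) : Prop :=
  (∃ h : ρ.pos ∈ T.pos, (ρ.letter, ρ.datum) = T.label ⟨ρ.pos, h⟩) ∧ T.HasType ρ.pos ρ.type

/-- `S 0, …, S n` is a run of `A` over `T`. -/
def IsRun (A : Automaton Alph Q) (T : DataTree Alph D) (n : ℕ)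
    (S : Fin (n + 1) → TreeConf Alph Q D) : Prop :=
  (∃ α a d, S 0 = {⟨[], α, a, d, {(A.init, d)}⟩}) ∧
  (∀ i : Fin n, TreeStep A (S i.castSucc) (S i.succ)) ∧
  (∀ i, ∀ ρ ∈ S i, ρ.IsOver T)

/-- The set of data trees over which `A` has an accepting run. -/
def Automaton.language (A : Automaton Alph Q) (D : Type u) : Set (DataTree Alph D) :=
  {T | ∃ n S, IsRun A T n S ∧ ∀ ρ ∈ S (Fin.last n), ρ.threads = ∅}

end Semantics

/-! ### Automata as inputs of an algorithm -/

/-- A finite description of an automaton: the number of letters, the number of the initial state,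
and the list of the instructions of all states, each given by an opcode and two arguments. -/
abbrev Code := ℕ × ℕ × List (ℕ × ℕ × ℕ)

def TypeTest.code : TypeTest → ℕ
  | .child => 0
  | .noChild => 1
  | .sibling => 2
  | .noSibling => 3

/-- Opcode and arguments of an instruction, for an alphabet and a set of states that are numbered
by `eA` and `eQ`. -/
def Instr.code {Alph : Type v} {Q : Type w} {k m : ℕ} (eA : Alph ≃ Fin k) (eQ : Q ≃ Fin m) :
    Instr Alph Q → ℕ × ℕ × ℕ
  | .letter a => (0, eA a, 0)
  | .notLetter a => (1, eA a, 0)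
  | .test b => (2, b.code, 0)
  | .store q => (3, eQ q, 0)
  | .eq => (4, 0, 0)
  | .neq => (5, 0, 0)
  | .and q q' => (6, eQ q, eQ q')
  | .or q q' => (7, eQ q, eQ q')
  | .down q => (8, eQ q, 0)
  | .right q => (9, eQ q, 0)
  | .guess q => (10, eQ q, 0)
  | .spread q q' => (11, eQ q, eQ q')

/-- The description of an automaton whose letters are numbered `0, …, k - 1` by `eA` and whose
states are numbered `0, …, m - 1` by `eQ`. -/
def Automaton.code {Alph : Type v} {Q : Type w} {k m : ℕ} (A : Automaton Alph Q)
    (eA : Alph ≃ Fin k) (eQ : Q ≃ Fin m) : Code :=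
  (k, eQ A.init, List.ofFn fun i => (A.δ (eQ.symm i)).code eA eQ)

end ATRA

/-!
An automaton is nonempty iff an initial node configuration is *winning*: its threads can be
eliminated by a finite derivation. The siblings and the children of a node are explored
independently, so a derivation is a binary tree, which is unfolded into an unranked data tree.

Winning is invariant under injective renamings of the data, and removing threads from a winning
configuration leaves it winning. Nonemptiness is recursively enumerable, as derivations are finite
objects. For emptiness, call a configuration losing if it is not winning. Up to renaming,
configurations are well-quasi-ordered by inclusion of threads (Dickson's lemma), and losing is
upward closed; hence there is an `N` such that each losing configuration contains a losing one with
at most `N` data. Taking the data from `{0, …, N}` leaves a spare datum in each of these, which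
represents all fresh guesses, so the finite list of the losing configurations of this kind is closed
under successors up to renaming and inclusion. Conversely a list that is closed in this sense
contains only losing configurations. This makes emptiness recursively enumerable as well, and the
theorem follows by Post's theorem.
-/

namespace ATRA

/-! ### Winning configurations -/

section Winning

variable {Alph : Type v} {Q : Type w} {D : Type u}

/-- The two directions in which an automaton moves. -/
inductive Dir
  | child
  | sibling

/-- Does a node of type `α` have a neighbour in the given direction? -/
def TreeType.has (α : TreeType) : Dir → Bool
  | .child => α.child
  | .sibling => α.sibling

/-- The instruction that moves in the given direction. -/
def Dir.instr : Dir → Q → Instr Alph Q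
  | .child => .down
  | .sibling => .right

/-- The threads that the threads of `Γ` become by moving in the given direction. -/
def moveSet (A : Automaton Alph Q) (dir : Dir) (Γ : Set (Q × D)) : Set (Q × D) :=
  {t | ∃ q, (q, t.2) ∈ Γ ∧ A.δ q = dir.instr t.1}

/-- The threads created by the instruction `spread q₂ q₁`. -/
def spreadSet (q₂ q₁ : Q) (Δ : Set (Q × D)) : Set (Q × D) :=
  {t | t.1 = q₁ ∧ (q₂, t.2) ∈ Δ}

/-- `WinsIn A L n α a d Γ`: at a node of type `α` with letter `a` and datum `d`, the threads `Γ` can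
be eliminated by a derivation of height at most `n`, where the letters of new nodes belong to `L`.
Replaced threads are removed from `Γ`, whereas the runs of the automaton may keep them. -/
inductive WinsIn (A : Automaton Alph Q) (L : Set Alph) :
    ℕ → TreeType → Alph → D → Set (Q × D) → Prop
  | empty {n : ℕ} {α : TreeType} {a : Alph} {d : D} : WinsIn A L n α a d ∅
  | thread {n : ℕ} {α : TreeType} {a : Alph} {d : D} {Γ N : Set (Q × D)} {t : Q × D} :
      t ∈ Γ → ThreadStep A α a d t N → WinsIn A L n α a d (N ∪ Γ \ {t}) →
      WinsIn A L (n + 1) α a d Γ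
  | spread {n : ℕ} {α : TreeType} {a : Alph} {d : D} {Γ : Set (Q × D)} {t : Q × D} {q₁ q₂ : Q} :
      t ∈ Γ → A.δ t.1 = .spread q₂ q₁ →
      (∀ s ∈ Γ \ {t}, (A.δ s.1).IsSpread ∨ (A.δ s.1).IsMoving) →
      WinsIn A L n α a d (spreadSet q₂ q₁ (Γ \ {t}) ∪ Γ \ {t}) → WinsIn A L (n + 1) α a d Γ
  | move {n : ℕ} {α : TreeType} {a : Alph} {d : D} {Γ : Set (Q × D)}
      {β : Dir → TreeType} {b : Dir → Alph} {e : Dir → D} :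
      (∀ t ∈ Γ, (A.δ t.1).IsMoving) → (∃ dir, α.has dir) → (∀ dir, α.has dir → b dir ∈ L) →
      (∀ dir, α.has dir → WinsIn A L n (β dir) (b dir) (e dir) (moveSet A dir Γ)) →
      WinsIn A L (n + 1) α a d Γ

/-- The threads of some node configuration that can start a run can be eliminated. -/
def Automaton.HasWinningStart (A : Automaton Alph Q) (L : Set Alph) (D : Type u) : Prop :=
  ∃ n c, ∃ a ∈ L, ∃ d : D, WinsIn A L n ⟨c, false⟩ a d {(A.init, d)}

variable {A : Automaton Alph Q} {L : Set Alph}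

theorem WinsIn.mono {n m : ℕ} (hnm : n ≤ m) {α : TreeType} {a : Alph} {d : D} {Γ : Set (Q × D)}
    (h : WinsIn A L n α a d Γ) : WinsIn A L m α a d Γ := by
  induction h generalizing m with
  | empty => exact .empty
  | thread ht hN _ ih =>
    obtain ⟨m, rfl⟩ := Nat.exists_eq_succ_of_ne_zero (by omega : m ≠ 0)
    exact .thread ht hN (ih (by omega))
  | spread ht hδ hall _ ih =>
    obtain ⟨m, rfl⟩ := Nat.exists_eq_succ_of_ne_zero (by omega : m ≠ 0)
    exact .spread ht hδ hall (ih (by omega))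
  | move hmov hex hb _ ih =>
    obtain ⟨m, rfl⟩ := Nat.exists_eq_succ_of_ne_zero (by omega : m ≠ 0)
    exact .move hmov hex hb fun dir hdir => ih dir hdir (by omega)

theorem WinsIn.of_moves {n : ℕ} {α : TreeType} {a : Alph} {d : D} {Γ : Set (Q × D)}
    (hmov : ∀ t ∈ Γ, (A.δ t.1).IsMoving) (hex : ∃ dir, α.has dir)
    (h : ∀ dir, α.has dir → ∃ β, ∃ b ∈ L, ∃ e, WinsIn A L n β b e (moveSet A dir Γ)) :
    WinsIn A L (n + 1) α a d Γ := by
  have : Nonempty TreeType := ⟨α⟩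
  have : Nonempty Alph := ⟨a⟩
  have : Nonempty D := ⟨d⟩
  choose! β b hb e hw using h
  exact .move hmov hex hb hw

theorem exists_winsIn_of_moves {α : TreeType} {a : Alph} {d : D} {Γ : Set (Q × D)}
    (hmov : ∀ t ∈ Γ, (A.δ t.1).IsMoving) (hex : ∃ dir, α.has dir)
    (h : ∀ dir, α.has dir → ∃ n β, ∃ b ∈ L, ∃ e, WinsIn A L n β b e (moveSet A dir Γ)) :
    ∃ n, WinsIn A L n α a d Γ := by
  choose! n h using h
  refine ⟨max (n .child) (n .sibling) + 1, .of_moves hmov hex fun dir hdir => ?_⟩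
  obtain ⟨β, b, hb, e, hw⟩ := h dir hdir
  have hle : n dir ≤ max (n .child) (n .sibling) := by cases dir <;> simp
  exact ⟨β, b, hb, e, hw.mono hle⟩

end Winning

/-! ### Simulations -/

section Correspondence

/-- A partial injection with finite domain, given by its graph. -/
structure FinBiUnique {X Y : Type*} (R : X → Y → Prop) : Prop where
  finite : {p : X × Y | R p.1 p.2}.Finite
  biUnique : Relator.BiUnique R

theorem finBiUnique_of_injOn {X Y : Type*} {S : Set X} {f : X → Y} (hS : S.Finite)
    (hf : Set.InjOn f S) : FinBiUnique fun x y => x ∈ S ∧ f x = y where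
  finite := (hS.image fun x => (x, f x)).subset <| by
    rintro ⟨x, y⟩ ⟨hx, hxy⟩
    exact ⟨x, hx, Prod.ext rfl hxy⟩
  biUnique := ⟨fun _ _ _ hx hy => hf hx.1 hy.1 (hx.2.trans hy.2.symm),
    fun _ _ _ hx hy => hx.2.symm.trans hy.2⟩

theorem biUnique_eq {X : Type*} : Relator.BiUnique (Eq : X → X → Prop) :=
  ⟨fun _ _ _ h h' => h.trans h'.symm, fun _ _ _ h h' => h.symm.trans h'⟩

theorem biUnique_flip {X Y : Type*} {R : X → Y → Prop} (h : Relator.BiUnique R) :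
    Relator.BiUnique (flip R) :=
  ⟨fun _ _ _ h₁ h₂ => h.2 h₁ h₂, fun _ _ _ h₁ h₂ => h.1 h₁ h₂⟩

theorem FinBiUnique.exists_extension {X Y : Type*} [Infinite X] {R : X → Y → Prop}
    (hR : FinBiUnique R) (y : Y) : ∃ R', FinBiUnique R' ∧ R ≤ R' ∧ ∃ x, R' x y := by
  by_cases hy : ∃ x, R x y
  · exact ⟨R, hR, le_rfl, hy⟩
  obtain ⟨x, hx⟩ := (hR.finite.image Prod.fst).exists_notMem
  have hx : ∀ z, ¬ R x z := fun z hz => hx ⟨(x, z), hz, rfl⟩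
  refine ⟨fun x' y' => R x' y' ∨ (x' = x ∧ y' = y), ⟨?_, ?_, ?_⟩, fun _ _ => .inl, x,
    .inr ⟨rfl, rfl⟩⟩
  · refine (hR.finite.union (Set.finite_singleton (x, y))).subset ?_
    rintro ⟨x', y'⟩ (h | ⟨rfl, rfl⟩)
    exacts [.inl h, .inr rfl]
  · rintro x₁ x₂ z (h₁ | ⟨rfl, rfl⟩) (h₂ | ⟨rfl, hz⟩)
    exacts [hR.biUnique.1 h₁ h₂, (hy ⟨x₁, hz ▸ h₁⟩).elim, (hy ⟨x₂, h₂⟩).elim, rfl]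
  · rintro z y₁ y₂ (h₁ | ⟨rfl, rfl⟩) (h₂ | ⟨hz, rfl⟩)
    exacts [hR.biUnique.2 h₁ h₂, (hx y₁ (hz ▸ h₁)).elim, (hx y₂ h₂).elim, rfl]

variable {Alph : Type v} {Q : Type w} {D : Type u} {Alph' Q' D' : Type*}

/-- Two instructions that agree up to a correspondence `RA` of letters and `RQ` of states. -/
inductive InstrRel (RA : Alph' → Alph → Prop) (RQ : Q' → Q → Prop) :
    Instr Alph' Q' → Instr Alph Q → Prop
  | letter {a' a} : RA a' a → InstrRel RA RQ (.letter a') (.letter a)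
  | notLetter {a' a} : RA a' a → InstrRel RA RQ (.notLetter a') (.notLetter a)
  | test {b} : InstrRel RA RQ (.test b) (.test b)
  | store {q' q} : RQ q' q → InstrRel RA RQ (.store q') (.store q)
  | eq : InstrRel RA RQ .eq .eq
  | neq : InstrRel RA RQ .neq .neq
  | and {q' q p' p} : RQ q' q → RQ p' p → InstrRel RA RQ (.and q' p') (.and q p)
  | or {q' q p' p} : RQ q' q → RQ p' p → InstrRel RA RQ (.or q' p') (.or q p)
  | down {q' q} : RQ q' q → InstrRel RA RQ (.down q') (.down q)
  | right {q' q} : RQ q' q → InstrRel RA RQ (.right q') (.right q)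
  | guess {q' q} : RQ q' q → InstrRel RA RQ (.guess q') (.guess q)
  | spread {q' q p' p} : RQ q' q → RQ p' p → InstrRel RA RQ (.spread q' p') (.spread q p)

/-- `Corr A' A L' L RA RQ`: along the correspondences `RA` of letters and `RQ` of states, the
automaton `A'` with letters from `L'` agrees with the automaton `A` with letters from `L`. -/
structure Corr (A' : Automaton Alph' Q') (A : Automaton Alph Q) (L' : Set Alph') (L : Set Alph)
    (RA : Alph' → Alph → Prop) (RQ : Q' → Q → Prop) : Prop where
  letters_biUnique : Relator.BiUnique RA
  states_biUnique : Relator.BiUnique RQ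
  init : RQ A'.init A.init
  instr : ∀ ⦃q' q⦄, RQ q' q → InstrRel RA RQ (A'.δ q') (A.δ q)
  exists_left : ∀ a ∈ L, ∃ a' ∈ L', RA a' a
  exists_right : ∀ a' ∈ L', ∃ a ∈ L, RA a' a

/-- Every thread of `Γ'` corresponds to a thread of `Γ`. -/
def Below (RQ : Q' → Q → Prop) (R : D' → D → Prop) (Γ' : Set (Q' × D')) (Γ : Set (Q × D)) :
    Prop :=
  ∀ t' ∈ Γ', ∃ t ∈ Γ, RQ t'.1 t.1 ∧ R t'.2 t.2

variable {A : Automaton Alph Q} {A' : Automaton Alph' Q'} {L : Set Alph} {L' : Set Alph'}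
  {RA : Alph' → Alph → Prop} {RQ : Q' → Q → Prop} {R R' : D' → D → Prop}
  {Γ Δ : Set (Q × D)} {Γ' Δ' : Set (Q' × D')}

theorem InstrRel.flip {φ' : Instr Alph' Q'} {φ : Instr Alph Q} (h : InstrRel RA RQ φ' φ) :
    InstrRel (flip RA) (flip RQ) φ φ' := by
  cases h <;> constructor <;> assumption

theorem InstrRel.isMoving {φ' : Instr Alph' Q'} {φ : Instr Alph Q} (h : InstrRel RA RQ φ' φ)
    (hφ : φ.IsMoving) : φ'.IsMoving := by
  rcases hφ with ⟨q, rfl⟩ | ⟨q, rfl⟩ <;> cases h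
  exacts [.inl ⟨_, rfl⟩, .inr ⟨_, rfl⟩]

theorem InstrRel.isSpread {φ' : Instr Alph' Q'} {φ : Instr Alph Q} (h : InstrRel RA RQ φ' φ)
    (hφ : φ.IsSpread) : φ'.IsSpread := by
  obtain ⟨q, p, rfl⟩ := hφ
  cases h
  exact ⟨_, _, rfl⟩

theorem InstrRel.exists_eq_instr {dir : Dir} {q' : Q'} {φ : Instr Alph Q}
    (h : InstrRel RA RQ (dir.instr q') φ) : ∃ q, φ = dir.instr q ∧ RQ q' q := by
  cases dir <;> cases h <;> exact ⟨_, rfl, ‹_›⟩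

theorem Corr.refl (A : Automaton Alph Q) (L : Set Alph) : Corr A A L L Eq Eq where
  letters_biUnique := biUnique_eq
  states_biUnique := biUnique_eq
  init := rfl
  instr := by
    rintro q _ rfl
    cases A.δ q <;> constructor <;> rfl
  exists_left a ha := ⟨a, ha, rfl⟩
  exists_right a ha := ⟨a, ha, rfl⟩

theorem Corr.symm (C : Corr A' A L' L RA RQ) : Corr A A' L L' (flip RA) (flip RQ) where
  letters_biUnique := biUnique_flip C.letters_biUnique
  states_biUnique := biUnique_flip C.states_biUnique
  init := C.init
  instr _ _ h := (C.instr h).flip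
  exists_left := C.exists_right
  exists_right := C.exists_left

theorem Below.mono (hR : R ≤ R') (h : Below RQ R Γ' Γ) : Below RQ R' Γ' Γ :=
  fun t' ht' => (h t' ht').imp fun _ ht => ⟨ht.1, ht.2.1, hR _ _ ht.2.2⟩

theorem Below.union (h : Below RQ R Γ' Γ) (h' : Below RQ R Δ' Δ) :
    Below RQ R (Γ' ∪ Δ') (Γ ∪ Δ) := by
  rintro t' (ht' | ht')
  · exact (h t' ht').imp fun _ ht => ⟨.inl ht.1, ht.2⟩
  · exact (h' t' ht').imp fun _ ht => ⟨.inr ht.1, ht.2⟩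

theorem Below.diff_singleton (hQ : Relator.BiUnique RQ) (hR : Relator.BiUnique R)
    (h : Below RQ R Γ' Γ) {q' : Q'} {q : Q} {x' : D'} {x : D} (hq : RQ q' q) (hx : R x' x) :
    Below RQ R (Γ' \ {(q', x')}) (Γ \ {(q, x)}) := by
  rintro s' ⟨hs', hne⟩
  obtain ⟨s, hs, h₁, h₂⟩ := h s' hs'
  refine ⟨s, ⟨hs, ?_⟩, h₁, h₂⟩
  rintro rfl
  exact hne (Prod.ext (hQ.1 h₁ hq) (hR.1 h₂ hx))

theorem Below.exists_or_diff_singleton (h : Below RQ R Γ' Γ) (q : Q) (x : D) :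
    (∃ q' x', (q', x') ∈ Γ' ∧ RQ q' q ∧ R x' x) ∨ Below RQ R Γ' (Γ \ {(q, x)}) := by
  rw [or_iff_not_imp_left]
  intro hno t' ht'
  obtain ⟨t, ht, h₁, h₂⟩ := h t' ht'
  refine ⟨t, ⟨ht, ?_⟩, h₁, h₂⟩
  rintro rfl
  exact hno ⟨_, _, ht', h₁, h₂⟩

theorem below_empty : Below RQ R ∅ Γ := fun _ h => h.elim

theorem below_singleton {q' : Q'} {q : Q} {x' : D'} {x : D} (hq : RQ q' q) (hx : R x' x) :
    Below RQ R {(q', x')} {(q, x)} := by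
  rintro _ rfl
  exact ⟨_, rfl, hq, hx⟩

namespace Corr

theorem threadStep [Infinite D'] (C : Corr A' A L' L RA RQ) (hR : FinBiUnique R) {α : TreeType}
    {a' : Alph'} {a : Alph} (ha : RA a' a) {d' : D'} {d : D} (hd : R d' d) {q' : Q'} {q : Q}
    {x' : D'} {x : D} (hq : RQ q' q) (hx : R x' x) {N : Set (Q × D)}
    (hN : ThreadStep A α a d (q, x) N) :
    ∃ R', FinBiUnique R' ∧ R ≤ R' ∧
      ∃ N', ThreadStep A' α a' d' (q', x') N' ∧ Below RQ R' N' N := by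
  have same {N'} (h : ThreadStep A' α a' d' (q', x') N') (hN' : Below RQ R N' N) :
      ∃ R', FinBiUnique R' ∧ R ≤ R' ∧
        ∃ N', ThreadStep A' α a' d' (q', x') N' ∧ Below RQ R' N' N :=
    ⟨R, hR, le_rfl, N', h, hN'⟩
  have hI := C.instr hq
  generalize hφ : A'.δ q' = φ at hI
  cases hN with
  | or_left hδ =>
    cases hδ ▸ hI with | or h₁ _ => exact same (.or_left hφ) (below_singleton h₁ hx)
  | or_right hδ =>
    cases hδ ▸ hI with | or _ h₂ => exact same (.or_right hφ) (below_singleton h₂ hx)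
  | and hδ =>
    cases hδ ▸ hI with
    | and h₁ h₂ => exact same (.and hφ) ((below_singleton h₁ hx).union (below_singleton h₂ hx))
  | store hδ =>
    cases hδ ▸ hI with | store h => exact same (.store hφ) (below_singleton h hd)
  | eq hδ hdx =>
    cases hδ ▸ hI with | eq => exact same (.eq hφ (hR.biUnique.1 hd (hdx ▸ hx))) below_empty
  | neq hδ hdx =>
    cases hδ ▸ hI with
    | neq => exact same (.neq hφ fun hdx' => hdx (hR.biUnique.2 hd (hdx' ▸ hx))) below_empty
  | test hδ hα =>
    cases hδ ▸ hI with | test => exact same (.test hφ hα) below_empty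
  | letter hδ hba =>
    cases hδ ▸ hI with
    | letter hb => exact same (.letter hφ (C.letters_biUnique.1 hb (hba ▸ ha))) below_empty
  | notLetter hδ hba =>
    cases hδ ▸ hI with
    | notLetter hb =>
      exact same (.notLetter hφ fun hba' => hba (C.letters_biUnique.2 hb (hba' ▸ ha))) below_empty
  | guess e hδ =>
    cases hδ ▸ hI with
    | guess h =>
      obtain ⟨R', hR', hle, e', he'⟩ := hR.exists_extension e
      exact ⟨R', hR', hle, _, .guess e' hφ, below_singleton h he'⟩

theorem below_moveSet (C : Corr A' A L' L RA RQ) (h : Below RQ R Γ' Γ) (dir : Dir) :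
    Below RQ R (moveSet A' dir Γ') (moveSet A dir Γ) := by
  rintro ⟨p', x'⟩ ⟨q', hq', hδ'⟩
  obtain ⟨⟨q, x⟩, hq, h₁, h₂⟩ := h _ hq'
  obtain ⟨p, hδ, hp⟩ := InstrRel.exists_eq_instr (hδ' ▸ C.instr h₁)
  exact ⟨(p, x), ⟨q, hq, hδ⟩, hp, h₂⟩

theorem below_spreadSet (C : Corr A' A L' L RA RQ) (h : Below RQ R Γ' Γ) {p' q' : Q'} {p q : Q}
    (hp : RQ p' p) (hq : RQ q' q) : Below RQ R (spreadSet p' q' Γ') (spreadSet p q Γ) := by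
  rintro ⟨_, x'⟩ ⟨rfl, hx'⟩
  obtain ⟨⟨r, x⟩, hr, h₁, h₂⟩ := h _ hx'
  obtain rfl : r = p := C.states_biUnique.2 h₁ hp
  exact ⟨(q, x), ⟨rfl, hr⟩, hq, h₂⟩

theorem winsIn [Infinite D'] (C : Corr A' A L' L RA RQ) {n : ℕ} {α : TreeType} {a' : Alph'}
    {a : Alph} {d' : D'} {d : D} (hR : FinBiUnique R) (ha : RA a' a) (hd : R d' d)
    (hΓ : Below RQ R Γ' Γ) (h : WinsIn A L n α a d Γ) : WinsIn A' L' n α a' d' Γ' := by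
  induction h generalizing R a' d' Γ' with
  | empty =>
    obtain rfl : Γ' = ∅ := Set.eq_empty_of_forall_notMem fun t ht => (hΓ t ht).choose_spec.1
    exact .empty
  | @thread n α a d Γ N t ht hN hw ih =>
    obtain ⟨q, x⟩ := t
    obtain ⟨q', x', ht', hq, hx⟩ | hΓ := hΓ.exists_or_diff_singleton q x
    · obtain ⟨R', hR', hle, N', hN', hNN⟩ := C.threadStep hR ha hd hq hx hN
      have hdiff := (hΓ.diff_singleton C.states_biUnique hR.biUnique hq hx).mono hle
      exact .thread ht' hN' (ih hR' ha (hle _ _ hd) (hNN.union hdiff))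
    · have hsub : Below RQ R Γ' (N ∪ Γ \ {(q, x)}) := by simpa using below_empty.union hΓ
      exact (ih hR ha hd hsub).mono n.le_succ
  | @spread n α a d Γ t q₁ q₂ ht hδ hall hw ih =>
    obtain ⟨q, x⟩ := t
    obtain ⟨q', x', ht', hq, hx⟩ | hΓ := hΓ.exists_or_diff_singleton q x
    · have hdiff := hΓ.diff_singleton C.states_biUnique hR.biUnique hq hx
      have hall' : ∀ s' ∈ Γ' \ {(q', x')}, (A'.δ s'.1).IsSpread ∨ (A'.δ s'.1).IsMoving := by
        intro s' hs'
        obtain ⟨s, hs, hI, _⟩ := hdiff s' hs'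
        exact (hall s hs).imp (C.instr hI).isSpread (C.instr hI).isMoving
      have hI := C.instr hq
      generalize hφ : A'.δ q' = φ at hI
      rw [hδ] at hI
      cases hI with
      | spread h₂ h₁ =>
        exact .spread ht' hφ hall' (ih hR ha hd ((C.below_spreadSet hdiff h₂ h₁).union hdiff))
    · have hsub : Below RQ R Γ' (spreadSet q₂ q₁ (Γ \ {(q, x)}) ∪ Γ \ {(q, x)}) := by
        simpa using below_empty.union hΓ
      exact (ih hR ha hd hsub).mono n.le_succ
  | move hmov hex hb _ ih =>
    refine .of_moves (fun t' ht' => ?_) hex fun dir hdir => ?_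
    · obtain ⟨t, ht, hI, _⟩ := hΓ t' ht'
      exact (C.instr hI).isMoving (hmov t ht)
    · obtain ⟨b', hb', hbb⟩ := C.exists_left _ (hb dir hdir)
      obtain ⟨R', hR', hle, e', he'⟩ := hR.exists_extension _
      exact ⟨_, b', hb', e', ih dir hdir hR' hbb he' ((C.below_moveSet hΓ dir).mono hle)⟩

theorem hasWinningStart [Infinite D'] (C : Corr A' A L' L RA RQ) (h : A.HasWinningStart L D) :
    A'.HasWinningStart L' D' := by
  obtain ⟨n, c, a, ha, d, hw⟩ := h
  obtain ⟨a', ha', haa⟩ := C.exists_left a ha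
  obtain ⟨d', -⟩ := Infinite.exists_notMem_finset (∅ : Finset D')
  have hR : FinBiUnique fun x y => x ∈ ({d'} : Set D') ∧ (fun _ => d) x = y :=
    finBiUnique_of_injOn (Set.finite_singleton d') (Set.injOn_singleton _ d')
  exact ⟨n, c, a', ha', d',
    C.winsIn hR haa ⟨rfl, rfl⟩ (below_singleton C.init ⟨rfl, rfl⟩) hw⟩

theorem hasWinningStart_iff [Infinite D] [Infinite D'] (C : Corr A' A L' L RA RQ) :
    A'.HasWinningStart L' D' ↔ A.HasWinningStart L D :=
  ⟨C.symm.hasWinningStart, C.hasWinningStart⟩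

end Corr

theorem WinsIn.rename [Infinite D'] {n : ℕ} {α : TreeType} {a : Alph} {d' : D'} {Γ : Set (Q × D)}
    {Γ' : Set (Q × D')} (f : D' → D) (hfin : Γ'.Finite)
    (hinj : Set.InjOn f (insert d' (Prod.snd '' Γ'))) (hΓ : ∀ t ∈ Γ', (t.1, f t.2) ∈ Γ)
    (h : WinsIn A L n α a (f d') Γ) : WinsIn A L n α a d' Γ' :=
  (Corr.refl A L).winsIn (finBiUnique_of_injOn ((hfin.image Prod.snd).insert d') hinj) rfl
    ⟨.inl rfl, rfl⟩ (fun t ht => ⟨_, hΓ t ht, rfl, .inr ⟨t, ht, rfl⟩, rfl⟩) h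

theorem WinsIn.anti [Infinite D] {n : ℕ} {α : TreeType} {a : Alph} {d : D} {Γ Γ' : Set (Q × D)}
    (hfin : Γ'.Finite) (hsub : Γ' ⊆ Γ) (h : WinsIn A L n α a d Γ) : WinsIn A L n α a d Γ' :=
  h.rename id hfin Function.injective_id.injOn hsub

end Correspondence

/-! ### Accepting runs give winning configurations -/

section Runs

variable {Alph : Type v} {Q : Type w} {D : Type u} {A : Automaton Alph Q}

/-- The threads of the node configuration can be eliminated. -/
def NodeConf.Winning (A : Automaton Alph Q) (ρ : NodeConf Alph Q D) : Prop :=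
  ∃ n, WinsIn A Set.univ n ρ.type ρ.letter ρ.datum ρ.threads

theorem NodeConf.winning_of_moves {ρ : NodeConf Alph Q D} (hmov : ρ.IsMoving A)
    (hex : ∃ dir, ρ.type.has dir)
    (h : ∀ dir, ρ.type.has dir →
      ∃ τ : NodeConf Alph Q D, (τ.threads : Set (Q × D)) = moveSet A dir ρ.threads ∧ τ.Winning A) :
    ρ.Winning A := by
  refine exists_winsIn_of_moves hmov hex fun dir hdir => ?_
  obtain ⟨τ, hτ, n, hn⟩ := h dir hdir
  exact ⟨n, _, _, trivial, _, hτ ▸ hn⟩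

theorem EpsStep.winning [Infinite D] {ρ τ : NodeConf Alph Q D} (h : EpsStep A ρ τ)
    (hτ : τ.Winning A) : ρ.Winning A := by
  have diff_subset {Γ Δ : Set (Q × D)} {t : Q × D} (hΓ : Γ = {t} ∪ Δ) : Γ \ {t} ⊆ Δ := by
    simp [hΓ]
  obtain ⟨n, hn⟩ := hτ
  cases h with
  | @thread x α a d Γ Γ' Δ t N hΓ hN hΓ' =>
    have ht : t ∈ (Γ : Set (Q × D)) := hΓ ▸ .inl rfl
    have hsub : N ∪ ↑Γ \ {t} ⊆ (Γ' : Set (Q × D)) :=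
      hΓ' ▸ Set.union_subset_union_right N (diff_subset hΓ)
    exact ⟨n + 1, .thread ht hN (hn.anti (Γ'.finite_toSet.subset hsub) hsub)⟩
  | @spread x α a d Γ Γ' Δ q q₁ q₂ d' hΓ hδ hall hΓ' =>
    have ht : (q, d') ∈ (Γ : Set (Q × D)) := hΓ ▸ .inl rfl
    have hdiff := diff_subset hΓ
    have hsub : spreadSet q₂ q₁ (↑Γ \ {(q, d')}) ∪ ↑Γ \ {(q, d')} ⊆ (Γ' : Set (Q × D)) :=
      hΓ' ▸ Set.union_subset_union (fun _ hs => ⟨hs.1, hdiff hs.2⟩) hdiff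
    exact ⟨n + 1, .spread ht hδ (fun s hs => hall s (hdiff hs))
      (hn.anti (Γ'.finite_toSet.subset hsub) hsub)⟩

theorem TreeStep.winning [Infinite D] {S₁ S₂ : TreeConf Alph Q D} (h : TreeStep A S₁ S₂)
    (h₂ : ∀ ρ ∈ S₂, ρ.Winning A) : ∀ ρ ∈ S₁, ρ.Winning A := by
  have of_head {S N : Set (NodeConf Alph Q D)} {ρ : NodeConf Alph Q D}
      (hS₁ : (S₁ : Set (NodeConf Alph Q D)) = {ρ} ∪ S)
      (hS₂ : (S₂ : Set (NodeConf Alph Q D)) = N ∪ S)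
      (hρ : (∀ τ ∈ N, τ.Winning A) → ρ.Winning A) : ∀ ρ ∈ S₁, ρ.Winning A := by
    intro σ hσ
    have h₂ : ∀ τ ∈ N ∪ S, τ.Winning A := hS₂ ▸ h₂
    obtain rfl | hσ := hS₁ ▸ Finset.mem_coe.2 hσ
    exacts [hρ fun τ hτ => h₂ τ (.inl hτ), h₂ σ (.inr hσ)]
  cases h with
  | eps hS₁ hS₂ hst => exact of_head hS₁ hS₂ fun hw => hst.winning (hw _ rfl)
  | child hS₁ hS₂ hα hst =>
    refine of_head hS₁ hS₂ fun hw => NodeConf.winning_of_moves hst.2.2.1 ⟨.child, hst.1⟩ ?_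
    rintro (_ | _) hdir
    exacts [⟨_, hst.2.2.2, hw _ rfl⟩, by simp [TreeType.has, hα] at hdir]
  | sibling hS₁ hS₂ hα hst =>
    refine of_head hS₁ hS₂ fun hw => NodeConf.winning_of_moves hst.2.2.1 ⟨.sibling, hst.1⟩ ?_
    rintro (_ | _) hdir
    exacts [by simp [TreeType.has, hα] at hdir, ⟨_, hst.2.2.2, hw _ rfl⟩]
  | both hS₁ hS₂ hα hst₁ hst₂ =>
    refine of_head hS₁ hS₂ fun hw => NodeConf.winning_of_moves hst₁.2.2.1 ⟨.child, hst₁.1⟩ ?_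
    rintro (_ | _) -
    exacts [⟨_, hst₁.2.2.2, hw _ (.inl rfl)⟩, ⟨_, hst₂.2.2.2, hw _ (.inr rfl)⟩]

theorem hasWinningStart_of_mem_language [Infinite D] {T : DataTree Alph D}
    (hT : T ∈ A.language D) : A.HasWinningStart Set.univ D := by
  obtain ⟨n, S, ⟨⟨α, a, d, h₀⟩, hstep, hover⟩, hlast⟩ := hT
  have hwin : ∀ i, ∀ ρ ∈ S i, ρ.Winning A := by
    intro i
    induction i using Fin.reverseInduction with
    | last =>
      intro ρ hρ
      rw [NodeConf.Winning, hlast ρ hρ, Finset.coe_empty]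
      exact ⟨0, .empty⟩
    | cast i ih => exact (hstep i).winning ih
  have hmem : (⟨[], α, a, d, {(A.init, d)}⟩ : NodeConf Alph Q D) ∈ S 0 := by simp [h₀]
  obtain ⟨c, s⟩ := α
  obtain rfl : s = false := by simpa using (hover 0 _ hmem).2.2
  obtain ⟨m, hm⟩ := hwin 0 _ hmem
  exact ⟨m, c, a, trivial, d, by simpa using hm⟩

end Runs

/-! ### Data trees from binary trees -/

section Trees

open BinaryTree (nil node)

variable {X : Type*}

/-- The subtree of `F` in the given direction: binary trees encode unranked forests, with the first
child as left subtree and the next sibling as right subtree. -/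
def Dir.next : Dir → BinaryTree X → BinaryTree X
  | .child => BinaryTree.left
  | .sibling => BinaryTree.right

/-- The part of `F` that starts at the position `p` of the unranked tree with the root of `F`: the
node at `p` together with its descendants, its right siblings, and their descendants. -/
def subtreeAt : List ℕ → BinaryTree X → BinaryTree X
  | [], F => F
  | i :: p, F => subtreeAt p (BinaryTree.right^[i] F.left)

theorem subtreeAt_nil (p : List ℕ) : subtreeAt p (nil : BinaryTree X) = nil := by
  induction p with
  | nil => rfl
  | cons i p ih => rw [subtreeAt, BinaryTree.left, Function.iterate_fixed (by rfl), ih]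

theorem subtreeAt_append (p q : List ℕ) (F : BinaryTree X) :
    subtreeAt (p ++ q) F = subtreeAt q (subtreeAt p F) := by
  induction p generalizing F with
  | nil => rfl
  | cons i _ ih => exact ih _

theorem subtreeAt_concat_zero (p : List ℕ) (F : BinaryTree X) :
    subtreeAt (p ++ [0]) F = (subtreeAt p F).left :=
  subtreeAt_append p [0] F

theorem subtreeAt_concat_succ (p : List ℕ) (i : ℕ) (F : BinaryTree X) :
    subtreeAt (p ++ [i + 1]) F = (subtreeAt (p ++ [i]) F).right := by
  simp only [subtreeAt_append, subtreeAt, Function.iterate_succ_apply']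

theorem finite_subtreeAt_iterate_right_ne_nil (F : BinaryTree X) :
    {p : ℕ × List ℕ | subtreeAt p.2 (BinaryTree.right^[p.1] F) ≠ nil}.Finite := by
  induction F with
  | nil =>
    refine Set.finite_empty.subset fun p hp => hp ?_
    rw [Function.iterate_fixed (by rfl), subtreeAt_nil]
  | node l F G hF hG =>
    refine (((Set.finite_singleton (0, [])).union (hF.image fun p => (0, p.1 :: p.2))).union
      (hG.image fun p => (p.1 + 1, p.2))).subset ?_
    rintro ⟨_ | i, p⟩ hp
    · cases p with
      | nil => exact .inl (.inl rfl)
      | cons j p => exact .inl (.inr ⟨(j, p), hp, rfl⟩)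
    · exact .inr ⟨(i, p), hp, rfl⟩

theorem finite_subtreeAt_ne_nil (F : BinaryTree X) : {p | subtreeAt p F ≠ nil}.Finite := by
  refine ((Set.finite_singleton []).union
    ((finite_subtreeAt_iterate_right_ne_nil F.left).image fun p => p.1 :: p.2)).subset ?_
  rintro (_ | ⟨i, p⟩) hp
  exacts [.inl rfl, .inr ⟨(i, p), hp, rfl⟩]

/-- The label of the root, and `l` for the empty tree. -/
def rootD (l : X) : BinaryTree X → X
  | .nil => l
  | .node l' _ _ => l'

variable {Alph : Type v} {Q : Type w} {D : Type u}

/-- The data tree with root label `l` and with the trees encoded by `F` below the root. -/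
noncomputable def toDataTree (l : Alph × D) (F : BinaryTree (Alph × D)) : DataTree Alph D where
  pos := (finite_subtreeAt_ne_nil (node l F nil)).toFinset
  root_mem := by simp [subtreeAt]
  prefix_closed p q h := by
    simp only [Set.Finite.mem_toFinset, Set.mem_ofPred_eq] at h ⊢
    rw [subtreeAt_append] at h
    exact fun hp => h (by rw [hp, subtreeAt_nil])
  sibling_closed p i h := by
    simp only [Set.Finite.mem_toFinset, Set.mem_ofPred_eq] at h ⊢
    rw [subtreeAt_concat_succ] at h
    exact fun hp => h (by rw [hp]; rfl)
  label p := rootD l (subtreeAt p.1 (node l F nil))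

variable {l : Alph × D} {F : BinaryTree (Alph × D)} {p : List ℕ}

theorem mem_pos_toDataTree : p ∈ (toDataTree l F).pos ↔ subtreeAt p (node l F nil) ≠ nil := by
  simp [toDataTree]

theorem exists_eq_concat_of_right_ne_nil (h : (subtreeAt p (node l F nil)).right ≠ nil) :
    ∃ q i, p = q ++ [i] := by
  obtain rfl | ⟨q, i, rfl⟩ := List.eq_nil_or_concat' p
  exacts [(h rfl).elim, ⟨q, i, rfl⟩]

theorem hasType_toDataTree {α : TreeType}
    (h : ∀ dir, dir.next (subtreeAt p (node l F nil)) ≠ nil ↔ α.has dir) :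
    (toDataTree l F).HasType p α := by
  refine ⟨?_, ?_⟩
  · rw [mem_pos_toDataTree, subtreeAt_concat_zero]
    exact (h .child).symm
  · constructor
    · intro hs
      have hright := (h .sibling).2 hs
      obtain ⟨q, i, rfl⟩ := exists_eq_concat_of_right_ne_nil hright
      refine ⟨q, i, rfl, ?_⟩
      rwa [mem_pos_toDataTree, subtreeAt_concat_succ]
    · rintro ⟨q, i, rfl, hi⟩
      rw [mem_pos_toDataTree, subtreeAt_concat_succ] at hi
      exact (h .sibling).1 hi

theorem isOver_toDataTree {α : TreeType} {a : Alph} {d : D} {F' : Dir → BinaryTree (Alph × D)}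
    (hp : subtreeAt p (node l F nil) = node (a, d) (F' .child) (F' .sibling))
    (hF : ∀ dir, F' dir ≠ nil ↔ α.has dir) (Γ : Finset (Q × D)) :
    (⟨p, α, a, d, Γ⟩ : NodeConf Alph Q D).IsOver (toDataTree l F) := by
  have hmem : p ∈ (toDataTree l F).pos := by simp [mem_pos_toDataTree, hp]
  refine ⟨⟨hmem, by simp [toDataTree, hp, rootD]⟩, hasType_toDataTree fun dir => ?_⟩
  rw [hp, ← hF dir]
  cases dir <;> rfl

end Trees

/-! ### Winning configurations give accepting runs -/

section Clearing

variable {Alph : Type v} {Q : Type w} {D : Type u} {A : Automaton Alph Q} {T : DataTree Alph D}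

/-- A step between tree configurations, the second of which is a configuration over `T`. -/
def StepOver (A : Automaton Alph Q) (T : DataTree Alph D) (S S' : TreeConf Alph Q D) : Prop :=
  TreeStep A S S' ∧ ∀ ρ ∈ S', ρ.IsOver T

/-- All threads of the tree configuration `S` over `T` can be eliminated by steps over `T`. -/
def Clears (A : Automaton Alph Q) (T : DataTree Alph D) (S : TreeConf Alph Q D) : Prop :=
  (∀ ρ ∈ S, ρ.IsOver T) ∧
    ∃ S', Relation.ReflTransGen (StepOver A T) S S' ∧ ∀ ρ ∈ S', ρ.threads = ∅

open Classical in
theorem TreeStep.union_right {S₁ S₂ : TreeConf Alph Q D} (h : TreeStep A S₁ S₂)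
    (S : TreeConf Alph Q D) : TreeStep A (S₁ ∪ S) (S₂ ∪ S) := by
  have union_eq {S' U : TreeConf Alph Q D} {N : Set (NodeConf Alph Q D)}
      (hS' : (S' : Set (NodeConf Alph Q D)) = N ∪ ↑U) : ↑(S' ∪ S) = N ∪ ↑(U ∪ S) := by
    rw [Finset.coe_union, hS', Finset.coe_union, Set.union_assoc]
  cases h with
  | eps h₁ h₂ hst => exact .eps (union_eq h₁) (union_eq h₂) hst
  | child h₁ h₂ hα hst => exact .child (union_eq h₁) (union_eq h₂) hα hst
  | sibling h₁ h₂ hα hst => exact .sibling (union_eq h₁) (union_eq h₂) hα hst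
  | both h₁ h₂ hα hst hst' => exact .both (union_eq h₁) (union_eq h₂) hα hst hst'

open Classical in
theorem reflTransGen_union_right {S₁ S₂ : TreeConf Alph Q D}
    (h : Relation.ReflTransGen (StepOver A T) S₁ S₂) {S : TreeConf Alph Q D}
    (hS : ∀ ρ ∈ S, ρ.IsOver T) : Relation.ReflTransGen (StepOver A T) (S₁ ∪ S) (S₂ ∪ S) :=
  h.lift (· ∪ S) fun _ _ hst =>
    ⟨hst.1.union_right S, fun ρ hρ => (Finset.mem_union.1 hρ).elim (hst.2 ρ) (hS ρ)⟩

open Classical in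
theorem Clears.union {S₁ S₂ : TreeConf Alph Q D} (h₁ : Clears A T S₁) (h₂ : Clears A T S₂) :
    Clears A T (S₁ ∪ S₂) := by
  obtain ⟨hover₁, U₁, hsteps₁, hempty₁⟩ := h₁
  obtain ⟨hover₂, U₂, hsteps₂, hempty₂⟩ := h₂
  have hU₁ : ∀ ρ ∈ U₁, ρ.IsOver T := by
    obtain rfl | ⟨_, _, hst⟩ := hsteps₁.cases_tail
    exacts [hover₁, hst.2]
  have hsteps₂' := reflTransGen_union_right hsteps₂ hU₁
  rw [Finset.union_comm S₂, Finset.union_comm U₂] at hsteps₂'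
  exact ⟨fun ρ hρ => (Finset.mem_union.1 hρ).elim (hover₁ ρ) (hover₂ ρ), U₁ ∪ U₂,
    (reflTransGen_union_right hsteps₁ hover₂).trans hsteps₂',
    fun ρ hρ => (Finset.mem_union.1 hρ).elim (hempty₁ ρ) (hempty₂ ρ)⟩

theorem Clears.of_treeStep {ρ : NodeConf Alph Q D} {S : TreeConf Alph Q D} (hρ : ρ.IsOver T)
    (hst : TreeStep A {ρ} S) (h : Clears A T S) : Clears A T {ρ} := by
  obtain ⟨hover, S', hsteps, hempty⟩ := h
  exact ⟨by simpa using hρ, S', hsteps.head ⟨hst, hover⟩, hempty⟩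

theorem Clears.of_epsStep {ρ τ : NodeConf Alph Q D} (hρ : ρ.IsOver T) (hst : EpsStep A ρ τ)
    (h : Clears A T {τ}) : Clears A T {ρ} :=
  .of_treeStep hρ (.eps (S := ∅) (by simp) (by simp) hst) h

theorem Clears.of_moves {ρ : NodeConf Alph Q D} (hρ : ρ.IsOver T) (hex : ∃ dir, ρ.type.has dir)
    (hc : ρ.type.child = true → ∃ τ, ChildStep A ρ τ ∧ Clears A T {τ})
    (hs : ρ.type.sibling = true → ∃ τ, SiblingStep A ρ τ ∧ Clears A T {τ}) :
    Clears A T {ρ} := by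
  classical
  have type_eq {b b' : Bool} (hb : ρ.type.child = b) (hb' : ρ.type.sibling = b') :
      ρ.type = ⟨b, b'⟩ := hb ▸ hb' ▸ rfl
  cases hchild : ρ.type.child <;> cases hsibling : ρ.type.sibling
  · obtain ⟨_ | _, hdir⟩ := hex
    exacts [(Bool.false_ne_true (hchild.symm.trans hdir)).elim,
      (Bool.false_ne_true (hsibling.symm.trans hdir)).elim]
  · obtain ⟨τ, hst, hτ⟩ := hs hsibling
    exact .of_treeStep hρ
      (.sibling (S := ∅) (by simp) (by simp) (type_eq hchild hsibling) hst) hτ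
  · obtain ⟨τ, hst, hτ⟩ := hc hchild
    exact .of_treeStep hρ (.child (S := ∅) (by simp) (by simp) (type_eq hchild hsibling) hst) hτ
  · obtain ⟨τ, hst, hτ⟩ := hc hchild
    obtain ⟨τ', hst', hτ'⟩ := hs hsibling
    refine .of_treeStep hρ (.both (S := ∅) (by simp) ?_ (type_eq hchild hsibling) hst hst')
      (hτ.union hτ')
    simp [Set.pair_comm]

end Clearing

section Realizing

open BinaryTree (nil node)

variable {Alph : Type v} {Q : Type w} {D : Type u} {A : Automaton Alph Q} {α : TreeType} {a : Alph}
  {d : D}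

theorem ThreadStep.finite {t : Q × D} {N : Set (Q × D)} (h : ThreadStep A α a d t N) :
    N.Finite := by
  cases h <;> simp

theorem finite_spreadSet {Γ : Set (Q × D)} (h : Γ.Finite) (q₂ q₁ : Q) :
    (spreadSet q₂ q₁ Γ).Finite := by
  refine (h.image fun t => (q₁, t.2)).subset ?_
  rintro ⟨_, x⟩ ⟨rfl, hx⟩
  exact ⟨_, hx, rfl⟩

theorem Dir.instr_injective (dir : Dir) :
    Function.Injective (dir.instr : Q → Instr Alph Q) := by
  cases dir
  exacts [fun _ _ => Instr.down.inj, fun _ _ => Instr.right.inj]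

theorem finite_moveSet {Γ : Set (Q × D)} (h : Γ.Finite) (dir : Dir) :
    (moveSet A dir Γ).Finite := by
  refine (h.biUnion (t := fun s => {t | A.δ s.1 = dir.instr t.1 ∧ t.2 = s.2}) fun s _ => ?_).subset
    fun t ⟨q, hq, hδ⟩ => Set.mem_biUnion hq ⟨hδ, rfl⟩
  refine Set.Subsingleton.finite fun t ht t' ht' => Prod.ext ?_ (ht.2.trans ht'.2.symm)
  exact dir.instr_injective (ht.1.symm.trans ht'.1)

/-- The subtrees `F` in the two directions suit the type `α`, and in every data tree where they are
attached to a node labelled `(a, d)`, the threads `Γ` at that node can be eliminated. -/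
structure Realizes (A : Automaton Alph Q) (α : TreeType) (a : Alph) (d : D) (Γ : Finset (Q × D))
    (F : Dir → BinaryTree (Alph × D)) : Prop where
  ne_nil_iff : ∀ dir, F dir ≠ nil ↔ α.has dir
  clears : ∀ l G p, subtreeAt p (node l G nil) = node (a, d) (F .child) (F .sibling) →
    Clears A (toDataTree l G) {⟨p, α, a, d, Γ⟩}

theorem exists_realizes_empty (A : Automaton Alph Q) (α : TreeType) (a : Alph) (d : D) :
    ∃ F, Realizes A α a d ∅ F := by
  let F dir : BinaryTree (Alph × D) := if α.has dir then node (a, d) nil nil else nil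
  have hF dir : F dir ≠ nil ↔ α.has dir := by simp [F]
  refine ⟨F, hF, fun l G p hp => ⟨?_, _, .refl, by simp⟩⟩
  simpa using isOver_toDataTree hp hF ∅

theorem Realizes.of_epsStep {Γ Γ' : Finset (Q × D)} {F : Dir → BinaryTree (Alph × D)}
    (h : Realizes A α a d Γ' F) (hst : ∀ p, EpsStep A ⟨p, α, a, d, Γ⟩ ⟨p, α, a, d, Γ'⟩) :
    Realizes A α a d Γ F :=
  ⟨h.ne_nil_iff, fun l G p hp =>
    .of_epsStep (isOver_toDataTree hp h.ne_nil_iff Γ) (hst p) (h.clears l G p hp)⟩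

theorem exists_realizes_of_moves {Γ : Finset (Q × D)} {Γ' : Dir → Finset (Q × D)}
    {β : Dir → TreeType} {b : Dir → Alph} {e : Dir → D} (hmov : ∀ t ∈ Γ, (A.δ t.1).IsMoving)
    (hex : ∃ dir, α.has dir) (hΓ' : ∀ dir, (Γ' dir : Set (Q × D)) = moveSet A dir Γ)
    (h : ∀ dir, α.has dir → ∃ F, Realizes A (β dir) (b dir) (e dir) (Γ' dir) F) :
    ∃ F, Realizes A α a d Γ F := by
  have hF : ∀ dir, ∃ F : BinaryTree (Alph × D), (F ≠ nil ↔ α.has dir) ∧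
      (α.has dir → ∀ l G p, subtreeAt p (node l G nil) = F →
        Clears A (toDataTree l G) {⟨p, β dir, b dir, e dir, Γ' dir⟩}) := by
    intro dir
    by_cases hdir : α.has dir
    · obtain ⟨F, hF⟩ := h dir hdir
      exact ⟨node (b dir, e dir) (F .child) (F .sibling), by simp [hdir], fun _ => hF.clears⟩
    · exact ⟨nil, by simp [hdir], fun hdir' => (hdir hdir').elim⟩
  choose F hne hclears using hF
  refine ⟨F, hne, fun l G p hp => .of_moves (isOver_toDataTree hp hne Γ) hex ?_ ?_⟩
  · intro hc
    refine ⟨_, ⟨hc, rfl, hmov, hΓ' .child⟩, hclears .child hc l G (p ++ [0]) ?_⟩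
    rw [subtreeAt_concat_zero, hp, BinaryTree.left]
  · intro hs
    have hright : (subtreeAt p (node l G nil)).right ≠ nil := by
      rw [hp]
      exact (hne .sibling).2 hs
    obtain ⟨q, i, rfl⟩ := exists_eq_concat_of_right_ne_nil hright
    refine ⟨_, ⟨hs, ⟨q, i, rfl, rfl⟩, hmov, hΓ' .sibling⟩,
      hclears .sibling hs l G (q ++ [i + 1]) ?_⟩
    rw [subtreeAt_concat_succ, hp, BinaryTree.right]

theorem WinsIn.exists_realizes {L : Set Alph} {n : ℕ} {Γ : Set (Q × D)}
    (h : WinsIn A L n α a d Γ) {Δ : Finset (Q × D)} (hΔ : (Δ : Set (Q × D)) = Γ) :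
    ∃ F, Realizes A α a d Δ F := by
  classical
  have erase_eq {t : Q × D} {Δ : Finset (Q × D)} : (↑(Δ.erase t) : Set (Q × D)) = ↑Δ \ {t} := by
    simp
  have eq_union {t : Q × D} {Δ : Finset (Q × D)} (ht : t ∈ (Δ : Set (Q × D))) :
      (Δ : Set (Q × D)) = {t} ∪ ↑(Δ.erase t) := by
    rw [erase_eq, Set.union_sdiff_cancel (Set.singleton_subset_iff.2 ht)]
  induction h generalizing Δ with
  | empty =>
    obtain rfl : Δ = ∅ := by simpa using hΔ
    exact exists_realizes_empty A _ _ _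
  | @thread _ _ _ _ _ _ t ht hN _ ih =>
    subst hΔ
    have hfin := hN.finite.union (Δ.finite_toSet.sdiff (t := {t}))
    obtain ⟨F, hF⟩ := ih hfin.coe_toFinset
    refine ⟨F, hF.of_epsStep fun p => .thread (eq_union ht) hN ?_⟩
    rw [hfin.coe_toFinset, erase_eq]
  | @spread _ _ _ _ _ t q₁ q₂ ht hδ hall _ ih =>
    subst hΔ
    have hdiff := Δ.finite_toSet.sdiff (t := {t})
    have hfin := (finite_spreadSet hdiff q₂ q₁).union hdiff
    obtain ⟨F, hF⟩ := ih hfin.coe_toFinset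
    refine ⟨F, hF.of_epsStep fun p => .spread (eq_union ht) hδ (fun s hs => hall s ?_) ?_⟩
    · rwa [← erase_eq]
    · rw [hfin.coe_toFinset, erase_eq]
      simp [spreadSet, and_comm]
  | move hmov hex _ _ ih =>
    subst hΔ
    have hfin dir := finite_moveSet (A := A) Δ.finite_toSet dir
    exact exists_realizes_of_moves hmov hex (fun dir => (hfin dir).coe_toFinset)
      fun dir hdir => ih dir hdir (hfin dir).coe_toFinset

theorem exists_fin_seq_of_reflTransGen {X : Type*} {r : X → X → Prop} {x y : X}
    (h : Relation.ReflTransGen r x y) : ∃ (n : ℕ) (S : Fin (n + 1) → X),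
      S 0 = x ∧ S (Fin.last n) = y ∧ ∀ i : Fin n, r (S i.castSucc) (S i.succ) := by
  induction h with
  | refl => exact ⟨0, fun _ => x, rfl, rfl, fun i => i.elim0⟩
  | @tail y z _ hyz ih =>
    obtain ⟨n, S, h₀, hlast, hst⟩ := ih
    refine ⟨n + 1, Fin.snoc S z, ?_, Fin.snoc_last .., Fin.lastCases ?_ fun i => ?_⟩
    · rw [← Fin.castSucc_zero, Fin.snoc_castSucc, h₀]
    · rwa [Fin.snoc_castSucc, Fin.succ_last, Fin.snoc_last, hlast]
    · rw [Fin.snoc_castSucc, Fin.succ_castSucc, Fin.snoc_castSucc]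
      exact hst i

theorem mem_language_of_clears {T : DataTree Alph D}
    (h : Clears A T {⟨[], α, a, d, {(A.init, d)}⟩}) : T ∈ A.language D := by
  obtain ⟨hover, S', hsteps, hempty⟩ := h
  obtain ⟨n, S, h₀, hlast, hst⟩ := exists_fin_seq_of_reflTransGen hsteps
  refine ⟨n, S, ⟨⟨α, a, d, h₀⟩, fun i => (hst i).1, fun i => ?_⟩, hlast ▸ hempty⟩
  induction i using Fin.induction with
  | zero => exact h₀ ▸ hover
  | succ i _ => exact (hst i).2

theorem language_nonempty_iff [Infinite D] :
    (A.language D).Nonempty ↔ A.HasWinningStart Set.univ D := by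
  refine ⟨fun ⟨T, hT⟩ => hasWinningStart_of_mem_language hT, ?_⟩
  rintro ⟨n, c, a, -, d, hw⟩
  obtain ⟨F, hF⟩ := hw.exists_realizes (Δ := {(A.init, d)}) (by simp)
  have hsibling : F .sibling = nil := by
    by_contra hne
    simpa [TreeType.has] using (hF.ne_nil_iff .sibling).1 hne
  exact ⟨_, mem_language_of_clears (hF.clears (a, d) (F .child) [] (by rw [hsibling, subtreeAt]))⟩

end Realizing

/-! ### Automata given by codes -/

section Codes

/-- The test with the given code; all numbers that are not codes stand for `noSibling`. -/
def TypeTest.decode : ℕ → TypeTest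
  | 0 => .child
  | 1 => .noChild
  | 2 => .sibling
  | _ => .noSibling

/-- The instruction with the given opcode and arguments; all numbers that are not opcodes stand for
`spread`. -/
def Instr.decode (i : ℕ × ℕ × ℕ) : Instr ℕ ℕ :=
  match i.1 with
  | 0 => .letter i.2.1
  | 1 => .notLetter i.2.1
  | 2 => .test (.decode i.2.1)
  | 3 => .store i.2.1
  | 4 => .eq
  | 5 => .neq
  | 6 => .and i.2.1 i.2.2
  | 7 => .or i.2.1 i.2.2
  | 8 => .down i.2.1
  | 9 => .right i.2.1
  | 10 => .guess i.2.1
  | _ => .spread i.2.1 i.2.2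

/-- The automaton described by a code; states that do not occur in the code get the instruction
`eq`. -/
def Code.automaton (c : Code) : Automaton ℕ ℕ :=
  ⟨c.2.1, fun q => Instr.decode (c.2.2.getD q (4, 0, 0))⟩

/-- The automaton described by the code has a winning initial configuration with data in `ℕ`. -/
def CodeNonempty (c : Code) : Prop :=
  c.automaton.HasWinningStart (Set.Iio c.1) ℕ

variable {Alph : Type v} {Q : Type w} {k m : ℕ}

theorem TypeTest.decode_code (b : TypeTest) : TypeTest.decode b.code = b := by
  cases b <;> rfl

theorem instrRel_decode_code (eA : Alph ≃ Fin k) (eQ : Q ≃ Fin m) (φ : Instr Alph Q) :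
    InstrRel (fun (a' : ℕ) a => a' = eA a) (fun (q' : ℕ) q => q' = eQ q)
      (Instr.decode (φ.code eA eQ)) φ := by
  cases φ with
  | test b =>
    suffices h : InstrRel _ _ (.test (.decode b.code)) (.test b) from h
    rw [b.decode_code]
    exact .test
  | _ => constructor <;> rfl

theorem corr_code (eA : Alph ≃ Fin k) (eQ : Q ≃ Fin m) (A : Automaton Alph Q) :
    Corr (A.code eA eQ).automaton A (Set.Iio k) Set.univ (fun a' a => a' = eA a)
      (fun q' q => q' = eQ q) where
  letters_biUnique := ⟨fun _ _ _ h h' => h.trans h'.symm,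
    fun _ _ _ h h' => eA.injective (Fin.ext (h.symm.trans h'))⟩
  states_biUnique := ⟨fun _ _ _ h h' => h.trans h'.symm,
    fun _ _ _ h h' => eQ.injective (Fin.ext (h.symm.trans h'))⟩
  init := rfl
  instr := by
    rintro _ q rfl
    have hδ : (A.code eA eQ).automaton.δ (eQ q) = Instr.decode ((A.δ q).code eA eQ) := by
      simp [Code.automaton, Automaton.code, List.getD]
    exact hδ ▸ instrRel_decode_code eA eQ (A.δ q)
  exists_left a _ := ⟨eA a, (eA a).isLt, rfl⟩
  exists_right a' ha' := ⟨eA.symm ⟨a', ha'⟩, trivial, by simp⟩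

theorem language_nonempty_iff_codeNonempty (eA : Alph ≃ Fin k) (eQ : Q ≃ Fin m)
    (A : Automaton Alph Q) (D : Type u) [Infinite D] :
    (A.language D).Nonempty ↔ CodeNonempty (A.code eA eQ) :=
  (language_nonempty_iff (A := A)).trans (corr_code eA eQ A).hasWinningStart_iff.symm

/-- The states to which an instruction refers. -/
def Instr.states : Instr Alph Q → Set Q
  | .store q | .down q | .right q | .guess q => {q}
  | .and q q' | .or q q' | .spread q q' => {q, q'}
  | _ => ∅

/-- All states to which the automaton refers are smaller than `m`. -/
structure Automaton.StatesLT (A : Automaton ℕ ℕ) (m : ℕ) : Prop where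
  init : A.init < m
  instr : ∀ q, ∀ p ∈ (A.δ q).states, p < m

theorem Instr.finite_states (φ : Instr Alph Q) : φ.states.Finite := by
  cases φ <;> simp [Instr.states]

theorem Code.exists_statesLT (c : Code) : ∃ m, c.automaton.StatesLT m := by
  let I := insert (4, 0, 0) {i | i ∈ c.2.2}
  have hI : I.Finite := (List.finite_toSet c.2.2).insert _
  have hfin : (insert c.2.1 (⋃ i ∈ I, (Instr.decode i).states)).Finite :=
    (hI.biUnion fun i _ => (Instr.decode i).finite_states).insert _
  obtain ⟨m, hm⟩ := hfin.bddAbove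
  refine ⟨m + 1, Nat.lt_succ_of_le (hm (.inl rfl)), fun q p hp => Nat.lt_succ_of_le (hm (.inr ?_))⟩
  refine Set.mem_biUnion (?_ : c.2.2.getD q (4, 0, 0) ∈ I) hp
  obtain hq | hq := lt_or_ge q c.2.2.length
  · rw [List.getD_eq_getElem _ _ hq]
    exact .inr (List.getElem_mem hq)
  · rw [List.getD_eq_default _ _ hq]
    exact .inl rfl

end Codes

/-! ### Effective successors -/

section Successors

section Replacement

variable {Alph : Type v} {Q : Type w} {D : Type u}

/-- `Replacement A α a d t Δ N`: at a node of type `α` with letter `a` and datum `d`, the threads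
`N` can replace the thread `t` in the presence of the other threads `Δ`. -/
inductive Replacement (A : Automaton Alph Q) (α : TreeType) (a : Alph) (d : D) (t : Q × D)
    (Δ : Set (Q × D)) : Set (Q × D) → Prop
  | thread {N : Set (Q × D)} : ThreadStep A α a d t N → Replacement A α a d t Δ N
  | spread {q₂ q₁ : Q} : A.δ t.1 = .spread q₂ q₁ →
      (∀ s ∈ Δ, (A.δ s.1).IsSpread ∨ (A.δ s.1).IsMoving) →
      Replacement A α a d t Δ (spreadSet q₂ q₁ Δ)

variable {A : Automaton Alph Q} {L : Set Alph} {n : ℕ} {α : TreeType} {a : Alph} {d : D}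
  {t : Q × D} {Γ Δ N : Set (Q × D)}

theorem WinsIn.replace (ht : t ∈ Γ) (hN : Replacement A α a d t (Γ \ {t}) N)
    (h : WinsIn A L n α a d (N ∪ Γ \ {t})) : WinsIn A L (n + 1) α a d Γ := by
  cases hN with
  | thread hN => exact .thread ht hN h
  | spread hδ hall => exact .spread ht hδ hall h

theorem ThreadStep.snd_mem (h : ThreadStep A α a d t N) :
    N ⊆ {s | s.2 = d ∨ s.2 = t.2} ∨ ∃ q e, A.δ t.1 = .guess q ∧ N = {(q, e)} := by
  cases h with
  | guess e hδ => exact .inr ⟨_, e, hδ, rfl⟩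
  | _ => exact .inl (by simp [Set.insert_subset_iff])

theorem ThreadStep.fst_mem (h : ThreadStep A α a d t N) : ∀ s ∈ N, s.1 ∈ (A.δ t.1).states := by
  cases h <;> simp_all [Instr.states]

theorem Replacement.fst_mem (h : Replacement A α a d t Δ N) :
    ∀ s ∈ N, s.1 ∈ (A.δ t.1).states := by
  cases h with
  | thread h => exact h.fst_mem
  | spread hδ _ =>
    rintro s ⟨hs, -⟩
    simp [hδ, hs, Instr.states]

theorem Replacement.finite (hΔ : Δ.Finite) (h : Replacement A α a d t Δ N) : N.Finite := by
  cases h with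
  | thread h => exact h.finite
  | spread _ _ => exact finite_spreadSet hΔ _ _

theorem WinsIn.eq_empty_or (h : WinsIn A L n α a d Γ) :
    Γ = ∅ ∨ ∃ m, n = m + 1 ∧
      ((∃ t ∈ Γ, ∃ N, Replacement A α a d t (Γ \ {t}) N ∧ WinsIn A L m α a d (N ∪ Γ \ {t})) ∨
        (∀ t ∈ Γ, (A.δ t.1).IsMoving) ∧ (∃ dir, α.has dir) ∧
          ∀ dir, α.has dir → ∃ β, ∃ b ∈ L, ∃ e, WinsIn A L m β b e (moveSet A dir Γ)) := by
  cases h with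
  | empty => exact .inl rfl
  | thread ht hN h => exact .inr ⟨_, rfl, .inl ⟨_, ht, _, .thread hN, h⟩⟩
  | spread ht hδ hall h => exact .inr ⟨_, rfl, .inl ⟨_, ht, _, .spread hδ hall, h⟩⟩
  | move hmov hex hb h =>
    exact .inr ⟨_, rfl, .inr ⟨hmov, hex, fun dir hdir => ⟨_, _, hb dir hdir, _, h dir hdir⟩⟩⟩

end Replacement

/-- A node configuration without its position; letters, states and data are natural numbers. -/
structure ListConf where
  type : TreeType
  letter : ℕ
  datum : ℕ
  threads : List (ℕ × ℕ)

namespace ListConf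

/-- The threads of `r` can be eliminated by a derivation of height at most `n`. -/
def Wins (A : Automaton ℕ ℕ) (L : Set ℕ) (n : ℕ) (r : ListConf) : Prop :=
  WinsIn A L n r.type r.letter r.datum {t | t ∈ r.threads}

/-- `r` is obtained from `s` by deleting threads. -/
def Le (r s : ListConf) : Prop :=
  r.type = s.type ∧ r.letter = s.letter ∧ r.datum = s.datum ∧ r.threads ⊆ s.threads

theorem Wins.mono {A : Automaton ℕ ℕ} {L : Set ℕ} {n m : ℕ} {r : ListConf} (hnm : n ≤ m)
    (h : r.Wins A L n) : r.Wins A L m :=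
  WinsIn.mono hnm h

theorem Wins.anti {A : Automaton ℕ ℕ} {L : Set ℕ} {n : ℕ} {r s : ListConf} (hrs : r.Le s)
    (h : s.Wins A L n) : r.Wins A L n := by
  obtain ⟨hα, ha, hd, hsub⟩ := hrs
  unfold Wins at h ⊢
  rw [hα, ha, hd]
  exact WinsIn.anti (List.finite_toSet _) hsub h

end ListConf

/-- The target state of an instruction that moves in the given direction. -/
def Instr.target : Dir → Instr ℕ ℕ → Option ℕ
  | .child, .down q => some q
  | .sibling, .right q => some q
  | _, _ => none

/-- List version of `moveSet`. -/
def moveList (A : Automaton ℕ ℕ) (dir : Dir) (Γ : List (ℕ × ℕ)) : List (ℕ × ℕ) :=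
  Γ.filterMap fun t => ((A.δ t.1).target dir).map fun q => (q, t.2)

/-- List version of `spreadSet`. -/
def spreadList (q₂ q₁ : ℕ) (Δ : List (ℕ × ℕ)) : List (ℕ × ℕ) :=
  (Δ.filter fun t => t.1 = q₂).map fun t => (q₁, t.2)

open Classical in
/-- The lists of threads that can replace a thread with instruction `φ` and datum `x` of `r` in the
presence of the other threads `Δ`, where only data below `M` are guessed. -/
noncomputable def replacements (A : Automaton ℕ ℕ) (M : ℕ) (r : ListConf) (x : ℕ)
    (Δ : List (ℕ × ℕ)) : Instr ℕ ℕ → List (List (ℕ × ℕ))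
  | .letter b => if b = r.letter then [[]] else []
  | .notLetter b => if b = r.letter then [] else [[]]
  | .test b => if b.Holds r.type then [[]] else []
  | .store q => [[(q, r.datum)]]
  | .eq => if r.datum = x then [[]] else []
  | .neq => if r.datum = x then [] else [[]]
  | .and q q' => [[(q, x), (q', x)]]
  | .or q q' => [[(q, x)], [(q', x)]]
  | .guess q => (List.range M).map fun e => [(q, e)]
  | .spread q₂ q₁ =>
    if ∀ s ∈ Δ, (A.δ s.1).IsSpread ∨ (A.δ s.1).IsMoving then [spreadList q₂ q₁ Δ] else []
  | .down _ | .right _ => []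

/-- The configurations that result from `r` by replacing one thread, where only data below `M` are
guessed. -/
noncomputable def epsSucc (A : Automaton ℕ ℕ) (M : ℕ) (r : ListConf) : List ListConf :=
  r.threads.flatMap fun t =>
    (replacements A M r t.2 (r.threads.filter fun s => s ≠ t) (A.δ t.1)).map fun N =>
      { r with threads := N ++ r.threads.filter fun s => s ≠ t }

variable {A : Automaton ℕ ℕ} {L : Set ℕ} {M n : ℕ} {r : ListConf} {t : ℕ × ℕ}
  {Γ Δ : List (ℕ × ℕ)} {N : Set (ℕ × ℕ)}

theorem Instr.target_eq_some {dir : Dir} {φ : Instr ℕ ℕ} {q : ℕ} :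
    φ.target dir = some q ↔ φ = dir.instr q := by
  cases dir <;> cases φ <;> simp [Instr.target, Dir.instr]

theorem setOf_mem_moveList (dir : Dir) :
    {t | t ∈ moveList A dir Γ} = moveSet A dir {t | t ∈ Γ} := by
  ext ⟨q, x⟩
  simp [moveList, moveSet, Instr.target_eq_some]

theorem setOf_mem_spreadList (q₂ q₁ : ℕ) :
    {t | t ∈ spreadList q₂ q₁ Δ} = spreadSet q₂ q₁ {t | t ∈ Δ} := by
  ext ⟨q, x⟩
  simp [spreadList, spreadSet, eq_comm, and_comm]

theorem setOf_mem_filter_ne (t : ℕ × ℕ) :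
    {s | s ∈ Γ.filter fun s => s ≠ t} = {s | s ∈ Γ} \ {t} := by
  ext s
  simp

theorem replacement_of_mem {N : List (ℕ × ℕ)} (h : N ∈ replacements A M r t.2 Δ (A.δ t.1)) :
    Replacement A r.type r.letter r.datum t {s | s ∈ Δ} {s | s ∈ N} := by
  obtain ⟨q, x⟩ := t
  have of_eq {N₀ : Set (ℕ × ℕ)} (hN : {s | s ∈ N} = N₀)
      (hstep : ThreadStep A r.type r.letter r.datum (q, x) N₀) :
      Replacement A r.type r.letter r.datum (q, x) {s | s ∈ Δ} {s | s ∈ N} :=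
    hN ▸ .thread hstep
  cases hδ : A.δ q <;> simp only [hδ, replacements, List.mem_ite_nil_right, List.mem_ite_nil_left,
    List.mem_cons, List.mem_map, List.mem_range, List.not_mem_nil, or_false] at h
  case letter =>
    obtain ⟨hb, rfl⟩ := h
    exact of_eq (by simp) (.letter hδ hb)
  case notLetter =>
    obtain ⟨hb, rfl⟩ := h
    exact of_eq (by simp) (.notLetter hδ hb)
  case test =>
    obtain ⟨hb, rfl⟩ := h
    exact of_eq (by simp) (.test hδ hb)
  case eq =>
    obtain ⟨hx, rfl⟩ := h
    exact of_eq (by simp) (.eq hδ hx)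
  case neq =>
    obtain ⟨hx, rfl⟩ := h
    exact of_eq (by simp) (.neq hδ hx)
  case store =>
    subst h
    exact of_eq (by simp) (.store hδ)
  case and =>
    subst h
    exact of_eq (by ext; simp) (.and hδ)
  case or =>
    obtain rfl | rfl := h
    exacts [of_eq (by simp) (.or_left hδ), of_eq (by simp) (.or_right hδ)]
  case guess =>
    obtain ⟨e, -, rfl⟩ := h
    exact of_eq (by simp) (.guess e hδ)
  case spread =>
    obtain ⟨hall, rfl⟩ := h
    exact setOf_mem_spreadList (Δ := Δ) _ _ ▸ .spread hδ hall

theorem exists_mem_replacements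
    (h : Replacement A r.type r.letter r.datum t {s | s ∈ Δ} N) (hM : ∀ s ∈ N, s.2 < M) :
    ∃ N' ∈ replacements A M r t.2 Δ (A.δ t.1), {s | s ∈ N'} = N := by
  cases h with
  | thread h =>
    cases h with
    | and hδ => exact ⟨_, by rw [hδ]; exact List.mem_singleton_self _, by ext; simp⟩
    | or_left hδ | or_right hδ | store hδ => simp [hδ, replacements]
    | eq hδ h | neq hδ h | test hδ h | letter hδ h | notLetter hδ h => simp [hδ, h, replacements]
    | guess e hδ => simpa [hδ, replacements] using hM
  | spread hδ hall =>
    exact ⟨_, by simpa [replacements, hδ] using hall, setOf_mem_spreadList _ _⟩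

theorem setOf_mem_append : {t | t ∈ Γ ++ Δ} = {t | t ∈ Γ} ∪ {t | t ∈ Δ} :=
  Set.ext fun _ => List.mem_append

theorem exists_of_mem_epsSucc {s : ListConf} (h : s ∈ epsSucc A M r) :
    ∃ t ∈ r.threads, ∃ N, Replacement A r.type r.letter r.datum t ({t | t ∈ r.threads} \ {t}) N ∧
      ∃ Γ, {t | t ∈ Γ} = N ∪ {t | t ∈ r.threads} \ {t} ∧ s = { r with threads := Γ } := by
  obtain ⟨t, ht, h⟩ := List.mem_flatMap.1 h
  obtain ⟨N, hN, rfl⟩ := List.mem_map.1 h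
  refine ⟨t, ht, _, setOf_mem_filter_ne t ▸ replacement_of_mem hN, _, ?_, rfl⟩
  rw [setOf_mem_append, setOf_mem_filter_ne]

theorem exists_mem_epsSucc (ht : t ∈ r.threads)
    (hN : Replacement A r.type r.letter r.datum t ({t | t ∈ r.threads} \ {t}) N)
    (hM : ∀ s ∈ N, s.2 < M) :
    ∃ Γ, {t | t ∈ Γ} = N ∪ {t | t ∈ r.threads} \ {t} ∧
      { r with threads := Γ } ∈ epsSucc A M r := by
  rw [← setOf_mem_filter_ne] at hN
  obtain ⟨N', hN', rfl⟩ := exists_mem_replacements hN hM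
  refine ⟨_, ?_, List.mem_flatMap.2 ⟨t, ht, List.mem_map.2 ⟨N', hN', rfl⟩⟩⟩
  rw [setOf_mem_append, setOf_mem_filter_ne]

theorem ListConf.Wins.of_mem_epsSucc {s : ListConf} (hs : s ∈ epsSucc A M r)
    (h : s.Wins A L n) : r.Wins A L (n + 1) := by
  obtain ⟨t, ht, N, hN, Γ, hΓ, rfl⟩ := exists_of_mem_epsSucc hs
  refine WinsIn.replace ht hN ?_
  rwa [← hΓ]

theorem snd_lt_of_mem_replacements {N : List (ℕ × ℕ)} (hd : r.datum < M) (ht : t.2 < M)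
    (hΔ : ∀ s ∈ Δ, s.2 < M) (h : N ∈ replacements A M r t.2 Δ (A.δ t.1)) : ∀ s ∈ N, s.2 < M := by
  have hN := replacement_of_mem h
  generalize hset : {s | s ∈ N} = N' at hN
  have hmem (s) : s ∈ N ↔ s ∈ N' := by simp [← hset]
  simp only [hmem]
  cases hN with
  | thread hstep =>
    obtain hsub | ⟨q, e, hδ, rfl⟩ := hstep.snd_mem
    · exact fun s hs => (hsub hs).elim (· ▸ hd) (· ▸ ht)
    · rintro _ rfl
      obtain ⟨e', he', rfl⟩ : ∃ e' < M, [(q, e')] = N := by simpa [hδ, replacements] using h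
      obtain rfl : e' = e := by simpa using hset
      exact he'
  | @spread q₂ _ _ _ => exact fun s hs => hΔ (q₂, s.2) hs.2

theorem snd_lt_of_mem_epsSucc {s : ListConf} (hd : r.datum < M) (hΓ : ∀ t ∈ r.threads, t.2 < M)
    (h : s ∈ epsSucc A M r) : ∀ t ∈ s.threads, t.2 < M := by
  obtain ⟨t, ht, h⟩ := List.mem_flatMap.1 h
  obtain ⟨N, hN, rfl⟩ := List.mem_map.1 h
  have hΔ : ∀ s ∈ r.threads.filter fun s => s ≠ t, s.2 < M :=
    fun s hs => hΓ s (List.mem_filter.1 hs).1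
  intro s hs
  exact (List.mem_append.1 hs).elim (snd_lt_of_mem_replacements hd (hΓ t ht) hΔ hN s) (hΔ s)

theorem fst_lt_of_mem_epsSucc {m : ℕ} {s : ListConf} (hA : A.StatesLT m)
    (hΓ : ∀ t ∈ r.threads, t.1 < m) (h : s ∈ epsSucc A M r) : ∀ t ∈ s.threads, t.1 < m := by
  obtain ⟨t, -, N, hN, Γ, hset, rfl⟩ := exists_of_mem_epsSucc h
  intro s hs
  rcases (Set.ext_iff.1 hset s).1 hs with hs | hs
  · exact hA.instr _ _ (hN.fst_mem s hs)
  · exact hΓ s hs.1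

theorem exists_of_mem_moveList {dir : Dir} (ht : t ∈ moveList A dir Γ) :
    ∃ q, (q, t.2) ∈ Γ ∧ t.1 ∈ (A.δ q).states := by
  obtain ⟨q, hq, hδ⟩ := (Set.ext_iff.1 (setOf_mem_moveList dir) t).1 ht
  exact ⟨q, hq, by cases dir <;> simp [hδ, Dir.instr, Instr.states]⟩

end Successors

/-! ### Certificates of nonemptiness -/

section WinCert

/-- The configuration `r` of rank `n` wins because smaller ranks in the list `C` do. The rank also
bounds the guessed data. -/
def Justified (A : Automaton ℕ ℕ) (k : ℕ) (C : List (ℕ × ListConf)) (n : ℕ) (r : ListConf) : Prop :=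
  r.threads = [] ∨ (∃ s ∈ epsSucc A n r, ∃ p ∈ C, p.1 < n ∧ s.Le p.2) ∨
    (∀ t ∈ r.threads, (A.δ t.1).IsMoving) ∧ (∃ dir, r.type.has dir) ∧
      ∀ dir, r.type.has dir →
        ∃ p ∈ C, p.1 < n ∧ p.2.letter < k ∧ moveList A dir r.threads ⊆ p.2.threads

/-- All ranked configurations in the list `C` are justified by the list itself. -/
def SelfJustified (A : Automaton ℕ ℕ) (k : ℕ) (C : List (ℕ × ListConf)) : Prop :=
  ∀ p ∈ C, Justified A k C p.1 p.2

/-- A list of ranked configurations that certifies that some initial configuration wins. -/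
def IsWinCert (A : Automaton ℕ ℕ) (k : ℕ) (C : List (ℕ × ListConf)) : Prop :=
  SelfJustified A k C ∧
    ∃ p ∈ C, p.2.type.sibling = false ∧ p.2.letter < k ∧ (A.init, p.2.datum) ∈ p.2.threads

variable {A : Automaton ℕ ℕ} {k n : ℕ} {r : ListConf} {C C' : List (ℕ × ListConf)}

theorem Justified.mono (hC : C ⊆ C') (h : Justified A k C n r) : Justified A k C' n r := by
  obtain h | ⟨s, hs, p, hp, hlt, hle⟩ | ⟨hmov, hex, h⟩ := h
  · exact .inl h
  · exact .inr (.inl ⟨s, hs, p, hC hp, hlt, hle⟩)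
  · refine .inr (.inr ⟨hmov, hex, fun dir hdir => ?_⟩)
    obtain ⟨p, hp, h⟩ := h dir hdir
    exact ⟨p, hC hp, h⟩

theorem SelfJustified.cons (hC : SelfJustified A k C) (h : Justified A k C n r) :
    SelfJustified A k ((n, r) :: C) := by
  rintro p (_ | ⟨_, hp⟩)
  exacts [h.mono (List.subset_cons_self _ _), (hC p hp).mono (List.subset_cons_self _ _)]

theorem SelfJustified.append (hC : SelfJustified A k C) (hC' : SelfJustified A k C') :
    SelfJustified A k (C ++ C') := by
  intro p hp
  obtain hp | hp := List.mem_append.1 hp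
  exacts [(hC p hp).mono (List.subset_append_left _ _),
    (hC' p hp).mono (List.subset_append_right _ _)]

theorem SelfJustified.wins (hC : SelfJustified A k C) (h : (n, r) ∈ C) :
    r.Wins A (Set.Iio k) n := by
  induction n using Nat.strong_induction_on generalizing r with
  | _ n ih =>
    obtain hr | ⟨s, hs, ⟨m, p⟩, hp, hlt, hle⟩ | ⟨hmov, hex, hmove⟩ := hC _ h
    · have hr : r.threads = [] := hr
      simp [ListConf.Wins, hr, WinsIn.empty]
    · exact (((ih m hlt hp).anti hle).of_mem_epsSucc hs).mono hlt
    · obtain ⟨n, rfl⟩ : ∃ m, n = m + 1 :=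
        let ⟨dir, hdir⟩ := hex
        let ⟨_, _, hlt, _⟩ := hmove dir hdir
        Nat.exists_eq_succ_of_ne_zero (by omega)
      refine WinsIn.of_moves hmov hex fun dir hdir => ?_
      obtain ⟨⟨m, p⟩, hp, hlt, hletter, hsub⟩ := hmove dir hdir
      refine ⟨p.type, p.letter, hletter, p.datum, ?_⟩
      have hw := (ih m hlt hp).mono (Nat.le_of_lt_succ hlt)
      exact setOf_mem_moveList dir ▸ WinsIn.anti (List.finite_toSet _) hsub hw

theorem exists_list_setOf_mem {X : Type*} {S : Set X} (hS : S.Finite) :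
    ∃ l : List X, {x | x ∈ l} = S :=
  ⟨hS.toFinset.toList, by simp⟩

theorem exists_lt_of_finite {X : Type*} {S : Set X} (hS : S.Finite) (f : X → ℕ) :
    ∃ M, ∀ x ∈ S, f x < M := by
  obtain ⟨M, hM⟩ := (hS.image f).bddAbove
  exact ⟨M + 1, fun x hx => Nat.lt_succ_of_le (hM ⟨x, hx, rfl⟩)⟩

theorem exists_justified_of_moves (hmov : ∀ t ∈ r.threads, (A.δ t.1).IsMoving)
    (hex : ∃ dir, r.type.has dir)
    (h : ∀ dir, r.type.has dir → ∃ C, SelfJustified A k C ∧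
      ∃ p ∈ C, p.2.letter < k ∧ moveList A dir r.threads ⊆ p.2.threads) :
    ∃ C m, SelfJustified A k C ∧ Justified A k C m r := by
  have htotal (dir) : ∃ C m, SelfJustified A k C ∧ (r.type.has dir →
      ∃ p ∈ C, p.1 < m ∧ p.2.letter < k ∧ moveList A dir r.threads ⊆ p.2.threads) := by
    by_cases hdir : r.type.has dir
    · obtain ⟨C, hC, p, hp, hsub⟩ := h dir hdir
      exact ⟨C, p.1 + 1, hC, fun _ => ⟨p, hp, p.1.lt_succ_self, hsub⟩⟩
    · exact ⟨[], 0, by simp [SelfJustified], fun h => (hdir h).elim⟩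
  choose C m hC hm using htotal
  refine ⟨C .child ++ C .sibling, max (m .child) (m .sibling), (hC _).append (hC _),
    .inr (.inr ⟨hmov, hex, fun dir hdir => ?_⟩)⟩
  obtain ⟨p, hp, hlt, hsub⟩ := hm dir hdir
  refine ⟨p, ?_, hlt.trans_le ?_, hsub⟩ <;> cases dir <;> simp [hp]

theorem exists_selfJustified_of_winsIn {α : TreeType} {a d : ℕ} {Γ : Set (ℕ × ℕ)} (hΓ : Γ.Finite)
    (h : WinsIn A (Set.Iio k) n α a d Γ) :
    ∃ C m Γ', SelfJustified A k C ∧ (m, ⟨α, a, d, Γ'⟩) ∈ C ∧ {t | t ∈ Γ'} = Γ := by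
  induction n using Nat.strong_induction_on generalizing α a d Γ with
  | _ n ih =>
    obtain ⟨Γ', rfl⟩ := exists_list_setOf_mem hΓ
    suffices h : ∃ C m, SelfJustified A k C ∧ Justified A k C m ⟨α, a, d, Γ'⟩ by
      obtain ⟨C, m, hC, hJ⟩ := h
      exact ⟨_, m, Γ', hC.cons hJ, List.mem_cons_self, rfl⟩
    obtain h | ⟨n, rfl, ⟨t, ht, N, hN, hw⟩ | ⟨hmov, hex, hmove⟩⟩ := h.eq_empty_or
    · have hnil : Γ' = [] := List.eq_nil_iff_forall_not_mem.2 (Set.eq_empty_iff_forall_notMem.1 h)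
      exact ⟨[], 0, by simp [SelfJustified], .inl hnil⟩
    · have hdiff := hΓ.subset (Set.sdiff_subset (t := {t}))
      have hNfin := hN.finite hdiff
      obtain ⟨C, m, Δ, hC, hmem, hΔ⟩ := ih n n.lt_succ_self (hNfin.union hdiff) hw
      obtain ⟨M, hM⟩ := exists_lt_of_finite hNfin Prod.snd
      obtain ⟨Δ', hΔ', hs⟩ := exists_mem_epsSucc (M := max M (m + 1)) (r := ⟨α, a, d, Γ'⟩) ht hN
        fun s hs => (hM s hs).trans_le (le_max_left _ _)
      have hlt : m < max M (m + 1) := m.lt_succ_self.trans_le (le_max_right _ _)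
      have hsub : Δ' ⊆ Δ := (hΔ'.trans hΔ.symm).subset
      exact ⟨C, _, hC, .inr (.inl ⟨_, hs, _, hmem, hlt, rfl, rfl, rfl, hsub⟩)⟩
    · refine exists_justified_of_moves hmov hex fun dir hdir => ?_
      obtain ⟨β, b, hb, e, hw⟩ := hmove dir hdir
      obtain ⟨C, m, Δ, hC, hmem, hΔ⟩ := ih n n.lt_succ_self (finite_moveSet hΓ dir) hw
      rw [← setOf_mem_moveList] at hΔ
      exact ⟨C, hC, _, hmem, hb, hΔ.symm.subset⟩

theorem hasWinningStart_iff_exists_isWinCert :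
    A.HasWinningStart (Set.Iio k) ℕ ↔ ∃ C, IsWinCert A k C := by
  constructor
  · rintro ⟨n, c, a, ha, d, hw⟩
    obtain ⟨C, m, Γ, hC, hmem, hΓ⟩ := exists_selfJustified_of_winsIn (Set.finite_singleton _) hw
    exact ⟨C, hC, _, hmem, rfl, ha, hΓ.symm.subset rfl⟩
  · rintro ⟨C, hC, ⟨n, ⟨c, _⟩, a, d, Γ⟩, hp, rfl, ha, hinit⟩
    refine ⟨n, c, a, ha, d, WinsIn.anti (Set.finite_singleton _) ?_ (hC.wins hp)⟩
    exact Set.singleton_subset_iff.2 hinit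

end WinCert

/-! ### Certificates of emptiness -/

section LossCert

/-- The configuration `r` contains a configuration from `F`. -/
def Covered (F : List ListConf) (r : ListConf) : Prop :=
  ∃ f ∈ F, f.Le r

/-- All data of `r` are below `M`, and some datum below `M` does not occur in `r`. -/
def ListConf.HasSpare (M : ℕ) (r : ListConf) : Prop :=
  r.datum < M ∧ (∀ t ∈ r.threads, t.2 < M) ∧
    ∃ e < M, e ≠ r.datum ∧ ∀ t ∈ r.threads, t.2 ≠ e

/-- The configuration `r` does not win in one step, and every way to continue from it with data
below `M` leads to a configuration that contains one from `F`. -/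
def LossClosed (A : Automaton ℕ ℕ) (k M : ℕ) (F : List ListConf) (r : ListConf) : Prop :=
  r.threads ≠ [] ∧ r.HasSpare M ∧ (∀ s ∈ epsSucc A M r, Covered F s) ∧
    ((∀ t ∈ r.threads, (A.δ t.1).IsMoving) → (∃ dir, r.type.has dir) →
      ∃ dir, r.type.has dir ∧
        ∀ β, ∀ a < k, ∀ e < M, Covered F ⟨β, a, e, moveList A dir r.threads⟩)

/-- A bound `M` and a list `F` of configurations that certify that no initial configuration wins. -/
def IsLossCert (A : Automaton ℕ ℕ) (k M : ℕ) (F : List ListConf) : Prop :=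
  (∀ r ∈ F, LossClosed A k M F r) ∧
    ∀ c, ∀ a < k, Covered F ⟨⟨c, false⟩, a, 0, [(A.init, 0)]⟩

variable {A : Automaton ℕ ℕ} {L : Set ℕ} {k m n M : ℕ} {r s : ListConf} {F : List ListConf}

section Soundness

variable {α : TreeType} {a d e₀ : ℕ} {t : ℕ × ℕ} {Γ Δ N : Set (ℕ × ℕ)}

theorem WinsIn.exists_datum_lt (hΓ : Γ.Finite) (hM : ∀ s ∈ Γ, s.2 < M) (he₀ : e₀ < M)
    (hspare : ∀ s ∈ Γ, s.2 ≠ e₀) (h : WinsIn A L n α a d Γ) : ∃ e < M, WinsIn A L n α a e Γ := by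
  obtain hd | hd := lt_or_ge d M
  · exact ⟨d, hd, h⟩
  refine ⟨e₀, he₀, WinsIn.rename (Equiv.swap e₀ d) hΓ (Equiv.injective _).injOn (fun s hs => ?_)
    (by rwa [Equiv.swap_apply_left])⟩
  rwa [Equiv.swap_apply_of_ne_of_ne (hspare s hs) ((hM s hs).trans_le hd).ne]

theorem Replacement.exists_data_lt (hΔ : Δ.Finite) (hd : d < M) (ht : t.2 < M)
    (hM : ∀ s ∈ Δ, s.2 < M) (he₀ : e₀ < M) (hne : e₀ ≠ d) (hspare : ∀ s ∈ Δ, s.2 ≠ e₀)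
    (hN : Replacement A α a d t Δ N) (h : WinsIn A L n α a d (N ∪ Δ)) :
    ∃ N, (∀ s ∈ N, s.2 < M) ∧ Replacement A α a d t Δ N ∧ WinsIn A L n α a d (N ∪ Δ) := by
  by_cases hNM : ∀ s ∈ N, s.2 < M
  · exact ⟨N, hNM, hN, h⟩
  obtain ⟨q, e, hδ, rfl, he⟩ : ∃ q e, A.δ t.1 = .guess q ∧ N = {(q, e)} ∧ M ≤ e := by
    cases hN with
    | thread hstep =>
      obtain hsub | ⟨q, e, hδ, rfl⟩ := hstep.snd_mem
      · exact (hNM fun s hs => (hsub hs).elim (· ▸ hd) (· ▸ ht)).elim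
      · exact ⟨q, e, hδ, rfl, by simpa using hNM⟩
    | @spread q₂ _ _ _ => exact (hNM fun s hs => hM (q₂, s.2) hs.2).elim
  refine ⟨{(q, e₀)}, by simpa using he₀, .thread (.guess (d' := t.2) e₀ hδ), ?_⟩
  have hswap {x} (hx₀ : x ≠ e₀) (hx : x < M) : Equiv.swap e₀ e x = x :=
    Equiv.swap_apply_of_ne_of_ne hx₀ (hx.trans_le he).ne
  refine WinsIn.rename (Equiv.swap e₀ e) ((Set.finite_singleton _).union hΔ)
    (Equiv.injective _).injOn ?_ (by rwa [hswap hne.symm hd])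
  rintro s (rfl | hs)
  · exact .inl (by simp)
  · rw [hswap (hspare s hs) (hM s hs)]
    exact .inr hs

theorem not_wins_of_covered (hF : ∀ f ∈ F, ¬ f.Wins A L n) (hr : Covered F r) :
    ¬ r.Wins A L n := by
  obtain ⟨f, hf, hle⟩ := hr
  exact fun h => hF f hf (h.anti hle)

theorem not_wins_of_lossClosed (hF : ∀ r ∈ F, LossClosed A k M F r) (hr : r ∈ F) :
    ¬ r.Wins A (Set.Iio k) n := by
  induction n using Nat.strong_induction_on generalizing r with
  | _ n ih =>
    intro hw
    obtain ⟨hne, ⟨hd, hM, e₀, he₀, hed, hspare⟩, heps, hmove⟩ := hF r hr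
    have hfin : {t | t ∈ r.threads}.Finite := List.finite_toSet _
    obtain h | ⟨n, rfl, ⟨t, ht, N, hN, h⟩ | ⟨hmov, hex, h⟩⟩ := WinsIn.eq_empty_or hw
    · exact hne (List.eq_nil_iff_forall_not_mem.2 (Set.eq_empty_iff_forall_notMem.1 h))
    · obtain ⟨N, hNM, hN, h⟩ := hN.exists_data_lt (hfin.subset Set.sdiff_subset) hd (hM t ht)
        (fun s hs => hM s hs.1) he₀ hed (fun s hs => hspare s hs.1) h
      obtain ⟨Γ, hΓ, hs⟩ := exists_mem_epsSucc ht hN hNM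
      rw [← hΓ] at h
      exact not_wins_of_covered (fun f hf => ih n n.lt_succ_self hf) (heps _ hs) h
    · obtain ⟨dir, hdir, hcov⟩ := hmove hmov hex
      obtain ⟨β, b, hb, e, h⟩ := h dir hdir
      obtain ⟨e, he, h⟩ := h.exists_datum_lt (finite_moveSet hfin dir)
        (fun s ⟨q, hq, _⟩ => hM (q, s.2) hq) he₀ fun s ⟨q, hq, _⟩ => hspare (q, s.2) hq
      rw [← setOf_mem_moveList] at h
      exact not_wins_of_covered (fun f hf => ih n n.lt_succ_self hf) (hcov β b hb e he) h

theorem IsLossCert.not_hasWinningStart (hF : IsLossCert A k M F) :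
    ¬ A.HasWinningStart (Set.Iio k) ℕ := by
  rintro ⟨n, c, a, ha, d, hw⟩
  refine not_wins_of_covered (fun f hf => not_wins_of_lossClosed hF.1 hf) (hF.2 c a ha) (n := n) ?_
  exact WinsIn.rename (fun _ => d) (List.finite_toSet _) (by simp) (by simp) hw

end Soundness

end LossCert

/-! ### Existence of certificates of emptiness -/

section WellQuasiOrder

theorem exists_bound_of_partiallyWellOrderedOn {X : Type*} {R : X → X → Prop} {S : Set X}
    (hS : S.PartiallyWellOrderedOn R) (size : X → ℕ) :
    ∃ N, ∀ x ∈ S, ∃ y ∈ S, R y x ∧ size y ≤ N := by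
  by_contra! h
  choose x hx hsize using h
  let bound : ℕ → ℕ := Nat.rec 0 fun _ N => max N (size (x N))
  have hmono : Monotone bound := monotone_nat_of_le_succ fun i => le_max_left _ _
  obtain ⟨i, j, hij, hR⟩ := hS fun i => ⟨x (bound i), hx _⟩
  have hle : size (x (bound i)) ≤ bound (i + 1) := le_max_right _ _
  exact (hsize _ _ (hx _) hR).not_ge (hle.trans (hmono hij))

theorem exists_injOn_of_card_fiber_le {X Y I : Type*} [Nonempty Y] [DecidableEq I]
    {S : Finset X} {T : Finset Y} {ℓ : X → I} {ℓ' : Y → I}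
    (h : ∀ i, (S.filter (ℓ · = i)).card ≤ (T.filter (ℓ' · = i)).card) :
    ∃ f : X → Y, Set.InjOn f S ∧ ∀ x ∈ S, f x ∈ T ∧ ℓ' (f x) = ℓ x := by
  have hfib (i) : ∃ f : X → Y, (S.filter (ℓ · = i) : Set X) ⊆ f ⁻¹' T.filter (ℓ' · = i) ∧
      Set.InjOn f (S.filter (ℓ · = i)) :=
    (Finset.finite_toSet _).exists_injOn_of_encard_le <| by
      simpa only [Set.encard_coe_eq_coe_finsetCard, Nat.cast_le] using h i
  choose f hmaps hinj using hfib
  have hmem {x} (hx : x ∈ S) : f (ℓ x) x ∈ T ∧ ℓ' (f (ℓ x) x) = ℓ x := by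
    simpa using hmaps (ℓ x) (by simpa using hx : x ∈ _)
  refine ⟨fun x => f (ℓ x) x, fun x hx y hy (hxy : f (ℓ x) x = f (ℓ y) y) => ?_, fun x => hmem⟩
  have hℓ : ℓ y = ℓ x := by rw [← (hmem hx).2, ← (hmem hy).2, hxy]
  rw [hℓ] at hxy
  exact hinj (ℓ x) (by simpa using hx) (by simpa using ⟨hy, hℓ⟩) hxy

end WellQuasiOrder

section Losing

namespace ListConf

/-- The data that occur in `r`. -/
def data (r : ListConf) : Finset ℕ :=
  insert r.datum (r.threads.map Prod.snd).toFinset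

/-- The configuration obtained from `r` by applying `f` to all data. -/
def map (f : ℕ → ℕ) (r : ListConf) : ListConf :=
  ⟨r.type, r.letter, f r.datum, r.threads.map fun t => (t.1, f t.2)⟩

/-- `r` becomes a part of `s` by an injective renaming of its data. -/
def Embeds (r s : ListConf) : Prop :=
  ∃ f : ℕ → ℕ, Set.InjOn f r.data ∧ (r.map f).Le s

/-- The letter of `r` is smaller than `k`, and its states are smaller than `m`. -/
def Bounded (k m : ℕ) (r : ListConf) : Prop :=
  r.letter < k ∧ ∀ t ∈ r.threads, t.1 < m

/-- The way in which the datum `e` occurs in `r`: whether it is the datum of the node, and the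
states below `m` with which it forms a thread. -/
def label (m : ℕ) (r : ListConf) (e : ℕ) : Prop × Set (Fin m) :=
  (e = r.datum, {q | (↑q, e) ∈ r.threads})

/-- No derivation eliminates the threads of `r`. -/
def Loses (A : Automaton ℕ ℕ) (k : ℕ) (r : ListConf) : Prop :=
  ∀ n, ¬ r.Wins A (Set.Iio k) n

variable {A : Automaton ℕ ℕ} {L : Set ℕ} {k m n M : ℕ} {r s u : ListConf} {f : ℕ → ℕ}

theorem Le.trans (h : r.Le s) (h' : s.Le u) : r.Le u :=
  ⟨h.1.trans h'.1, h.2.1.trans h'.2.1, h.2.2.1.trans h'.2.2.1, fun _ ht => h'.2.2.2 (h.2.2.2 ht)⟩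

theorem mem_data_of_mem {t : ℕ × ℕ} (ht : t ∈ r.threads) : t.2 ∈ r.data := by
  simpa [data] using .inr ⟨t.1, ht⟩

theorem Le.data_subset (h : r.Le s) : r.data ⊆ s.data := by
  intro e he
  obtain rfl | ⟨q, hq⟩ : e = r.datum ∨ ∃ q, (q, e) ∈ r.threads := by simpa [data] using he
  · simp [data, h.2.2.1]
  · exact mem_data_of_mem (h.2.2.2 hq)

theorem data_map : (r.map f).data = r.data.image f := by
  ext e
  simp only [data, map]
  aesop

theorem Bounded.anti (h : r.Le s) (hs : s.Bounded k m) : r.Bounded k m :=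
  ⟨h.2.1 ▸ hs.1, fun t ht => hs.2 t (h.2.2.2 ht)⟩

theorem Wins.of_map (hf : Set.InjOn f r.data) (h : (r.map f).Wins A L n) : r.Wins A L n := by
  refine WinsIn.rename f (List.finite_toSet _) (hf.mono ?_) (fun t ht => ?_) h
  · rintro _ (rfl | ⟨t, ht, rfl⟩)
    exacts [by simp [data], mem_data_of_mem ht]
  · exact List.mem_map.2 ⟨t, ht, rfl⟩

theorem Loses.mono (h : r.Le s) (hr : r.Loses A k) : s.Loses A k :=
  fun n hs => hr n (hs.anti h)

theorem Loses.map (hf : Set.InjOn f r.data) (hr : r.Loses A k) : (r.map f).Loses A k :=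
  fun n h => hr n (h.of_map hf)

theorem embeds_of_card_label_le (hr : r.Bounded k m) (hα : r.type = s.type)
    (ha : r.letter = s.letter)
    (h : ∀ i, (r.data.filter (r.label m · = i)).card ≤ (s.data.filter (s.label m · = i)).card) :
    r.Embeds s := by
  classical
  obtain ⟨f, hinj, hf⟩ := exists_injOn_of_card_fiber_le h
  refine ⟨f, hinj, hα, ha, ?_, fun t ht => ?_⟩
  · have hdatum := congrArg Prod.fst (hf r.datum (by simp [data])).2
    exact hdatum.mpr rfl
  · obtain ⟨u, hu, rfl⟩ := List.mem_map.1 ht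
    have hstates := congrArg Prod.snd (hf u.2 (mem_data_of_mem hu)).2
    exact (Set.ext_iff.1 hstates ⟨u.1, hr.2 u hu⟩).2 hu

end ListConf

open ListConf

instance : Finite TreeType :=
  Finite.of_injective (fun α => (α.child, α.sibling)) fun ⟨_, _⟩ ⟨_, _⟩ h => by simpa using h

theorem partiallyWellOrderedOn_embeds (k m : ℕ) :
    {r : ListConf | r.Bounded k m}.PartiallyWellOrderedOn Embeds := by
  classical
  intro u
  have hwqo := (Finite.wellQuasiOrdered (Eq : TreeType × Fin k → _ → Prop)).prod
    (wellQuasiOrdered_le (α := Prop × Set (Fin m) → ℕ))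
  obtain ⟨i, j, hij, heq, hle⟩ := hwqo fun i =>
    (((u i).1.type, ⟨(u i).1.letter, (u i).2.1⟩),
      fun l => ((u i).1.data.filter ((u i).1.label m · = l)).card)
  simp only [Prod.mk.injEq, Fin.mk.injEq] at heq
  exact ⟨i, j, hij, embeds_of_card_label_le (u i).2 heq.1 heq.2 hle⟩

variable {A : Automaton ℕ ℕ} {k m M N : ℕ} {r : ListConf} {F : List ListConf}

theorem exists_loses_card_data_le (A : Automaton ℕ ℕ) (k m : ℕ) :
    ∃ N, ∀ s : ListConf, s.Bounded k m → s.Loses A k →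
      ∃ r : ListConf, r.Le s ∧ r.Loses A k ∧ r.data.card ≤ N := by
  obtain ⟨N, hN⟩ := exists_bound_of_partiallyWellOrderedOn
    ((partiallyWellOrderedOn_embeds k m).mono
      (Set.inter_subset_left (t := {r | r.Loses A k}))) fun r => r.data.card
  refine ⟨N, fun s hs hlose => ?_⟩
  obtain ⟨r, ⟨-, hr⟩, ⟨f, hf, hle⟩, hcard⟩ := hN s ⟨hs, hlose⟩
  refine ⟨r.map f, hle, hr.map hf, ?_⟩
  rw [data_map]
  exact Finset.card_image_le.trans hcard

theorem exists_list_of_bounded (k m M : ℕ) :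
    ∃ F : List ListConf, ∀ r : ListConf, r.Bounded k m → r.data ⊆ Finset.range M →
      ∃ s ∈ F, s.Le r ∧ r.Le s := by
  let conf : TreeType × ℕ × ℕ × Finset (ℕ × ℕ) → ListConf :=
    fun p => ⟨p.1, p.2.1, p.2.2.1, p.2.2.2.toList⟩
  obtain ⟨F, hF⟩ := exists_list_setOf_mem <| Set.Finite.image conf <|
    (Set.finite_univ (α := TreeType)).prod <| (Set.finite_Iio k).prod <|
      (Set.finite_Iio M).prod (Finset.range m ×ˢ Finset.range M).powerset.finite_toSet
  refine ⟨F, fun r hr hdata => ⟨conf (r.type, r.letter, r.datum, r.threads.toFinset), ?_, ?_, ?_⟩⟩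
  · refine (Set.ext_iff.1 hF _).2 ⟨_, ⟨trivial, Set.mem_Iio.2 hr.1, ?_, ?_⟩, rfl⟩
    · exact Finset.mem_range.1 (hdata (by simp [data]))
    · refine Finset.mem_coe.2 (Finset.mem_powerset.2 fun t ht => ?_)
      have ht := List.mem_toFinset.1 ht
      exact Finset.mem_product.2 ⟨Finset.mem_range.2 (hr.2 t ht), hdata (mem_data_of_mem ht)⟩
  · exact ⟨rfl, rfl, rfl, fun t ht => by simpa [conf] using ht⟩
  · exact ⟨rfl, rfl, rfl, fun t ht => by simpa [conf] using ht⟩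

theorem hasSpare_of_card_lt (hdata : r.data ⊆ Finset.range M) (hcard : r.data.card < M) :
    r.HasSpare M := by
  obtain ⟨e, he, hne⟩ := Finset.exists_mem_notMem_of_card_lt_card
    (hcard.trans_eq (Finset.card_range M).symm)
  refine ⟨Finset.mem_range.1 (hdata (by simp [data])),
    fun t ht => Finset.mem_range.1 (hdata (mem_data_of_mem ht)), e, Finset.mem_range.1 he, ?_, ?_⟩
  · rintro rfl
    exact hne (by simp [data])
  · rintro t ht rfl
    exact hne (mem_data_of_mem ht)

theorem data_subset_range (hd : r.datum < M) (hΓ : ∀ t ∈ r.threads, t.2 < M) :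
    r.data ⊆ Finset.range M := by
  intro e he
  obtain rfl | ⟨q, hq⟩ : e = r.datum ∨ ∃ q, (q, e) ∈ r.threads := by simpa [data] using he
  exacts [Finset.mem_range.2 hd, Finset.mem_range.2 (hΓ _ hq)]

theorem ListConf.Loses.lossClosed (hA : A.StatesLT m) (hr : r.Bounded k m) (hlose : r.Loses A k)
    (hspare : r.HasSpare M)
    (hF : ∀ s : ListConf, s.Bounded k m → s.Loses A k → s.data ⊆ Finset.range M → Covered F s) :
    LossClosed A k M F r := by
  refine ⟨fun h => hlose 0 (by simp [Wins, h, WinsIn.empty]), hspare, fun s hs => ?_,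
    fun hmov hex => ?_⟩
  · obtain ⟨_, _, _, _, Γ, _, rfl⟩ := exists_of_mem_epsSucc hs
    refine hF _ ⟨hr.1, fst_lt_of_mem_epsSucc hA hr.2 hs⟩
      (fun n h => hlose _ (h.of_mem_epsSucc hs)) (data_subset_range hspare.1 ?_)
    exact snd_lt_of_mem_epsSucc hspare.1 hspare.2.1 hs
  · by_contra! hwin
    obtain ⟨n, hn⟩ : ∃ n, r.Wins A (Set.Iio k) n := by
      refine exists_winsIn_of_moves hmov hex fun dir hdir => ?_
      obtain ⟨β, a, ha, e, he, hcov⟩ := hwin dir hdir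
      have hb : Bounded k m ⟨β, a, e, moveList A dir r.threads⟩ := by
        refine ⟨ha, fun t ht => ?_⟩
        obtain ⟨q, -, hq⟩ := exists_of_mem_moveList ht
        exact hA.instr q _ hq
      have hdata : data ⟨β, a, e, moveList A dir r.threads⟩ ⊆ Finset.range M := by
        refine data_subset_range he fun t ht => ?_
        obtain ⟨q, hq, -⟩ := exists_of_mem_moveList ht
        exact hspare.2.1 (q, t.2) hq
      by_contra! hno
      refine hcov (hF _ hb (fun n hn => hno n β a ha e ?_) hdata)
      rwa [← setOf_mem_moveList]
    exact hlose n hn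

theorem exists_isLossCert (hA : A.StatesLT m) (h : ¬ A.HasWinningStart (Set.Iio k) ℕ) :
    ∃ M F, IsLossCert A k M F := by
  classical
  obtain ⟨N, hN⟩ := exists_loses_card_data_le A k m
  obtain ⟨F₀, hF₀⟩ := exists_list_of_bounded k m (N + 1)
  let F := F₀.filter fun r => r.Bounded k m ∧ r.Loses A k ∧ r.data ⊆ Finset.range (N + 1) ∧
    r.data.card ≤ N
  have hF (s : ListConf) (hs : s.Bounded k m) (hlose : s.Loses A k)
      (hdata : s.data ⊆ Finset.range (N + 1)) : Covered F s := by
    obtain ⟨r, hrs, hr, hcard⟩ := hN s hs hlose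
    obtain ⟨f, hf, hfr, hrf⟩ := hF₀ r (hs.anti hrs) (hrs.data_subset.trans hdata)
    refine ⟨f, List.mem_filter.2 ⟨hf, ?_⟩, hfr.trans hrs⟩
    have hfs := hfr.trans hrs
    exact decide_eq_true ⟨hs.anti hfs, hr.mono hrf, hfs.data_subset.trans hdata,
      (Finset.card_le_card hfr.data_subset).trans hcard⟩
  refine ⟨N + 1, F, fun r hr => ?_, fun c a ha => ?_⟩
  · obtain ⟨hr, hlose, hdata, hcard⟩ := of_decide_eq_true (List.mem_filter.1 hr).2
    exact hlose.lossClosed hA hr (hasSpare_of_card_lt hdata (Nat.lt_succ_of_le hcard)) hF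
  · refine hF _ ⟨ha, by simpa using hA.init⟩ (fun n hw => h ⟨n, c, a, ha, 0, ?_⟩) (by simp [data])
    simpa [Wins] using hw

theorem not_hasWinningStart_iff_exists_isLossCert (hA : A.StatesLT m) :
    ¬ A.HasWinningStart (Set.Iio k) ℕ ↔ ∃ M F, IsLossCert A k M F :=
  ⟨exists_isLossCert hA, fun ⟨_, _, h⟩ => h.not_hasWinningStart⟩

end Losing

/-! ### Decidability -/

section Decidability

open Primrec

variable {α β σ : Type*} [Primcodable α] [Primcodable β] [Primcodable σ]

theorem primrecPred_imp {p q : α → Prop} (hp : PrimrecPred p) (hq : PrimrecPred q) :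
    PrimrecPred fun x => p x → q x :=
  (hp.not.or hq).of_eq fun _ => imp_iff_not_or.symm

theorem primrecPred_forall_mem {f : α → List β} {p : α → β → Prop} (hf : Primrec f)
    (hp : PrimrecPred fun z : α × β => p z.1 z.2) : PrimrecPred fun x => ∀ y ∈ f x, p x y :=
  (PrimrecRel.forall_mem_list (R := fun y x => p x y) (PrimrecRel.swap (r := p) hp)).comp hf
    Primrec.id

theorem primrecPred_exists_mem {f : α → List β} {p : α → β → Prop} (hf : Primrec f)
    (hp : PrimrecPred fun z : α × β => p z.1 z.2) : PrimrecPred fun x => ∃ y ∈ f x, p x y :=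
  (PrimrecRel.exists_mem_list (R := fun y x => p x y) (PrimrecRel.swap (r := p) hp)).comp hf
    Primrec.id

theorem primrecPred_forall_lt {f : α → ℕ} {p : α → ℕ → Prop} (hf : Primrec f)
    (hp : PrimrecPred fun z : α × ℕ => p z.1 z.2) : PrimrecPred fun x => ∀ y < f x, p x y :=
  (primrecPred_forall_mem (list_range.comp hf) hp).of_eq fun _ => by simp

theorem primrecPred_exists_lt {f : α → ℕ} {p : α → ℕ → Prop} (hf : Primrec f)
    (hp : PrimrecPred fun z : α × ℕ => p z.1 z.2) : PrimrecPred fun x => ∃ y < f x, p x y :=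
  (primrecPred_exists_mem (list_range.comp hf) hp).of_eq fun _ => by simp

theorem primrecPred_forall_finite {I : Type*} [Finite I] {p : α → I → Prop}
    (hp : ∀ i, PrimrecPred fun x => p x i) : PrimrecPred fun x => ∀ i, p x i := by
  have hlist (l : List I) : PrimrecPred fun x => ∀ i ∈ l, p x i := by
    induction l with
    | nil => exact ⟨fun _ => .isTrue (by simp), (const true).of_eq fun _ => by simp⟩
    | cons i l ih => exact ((hp i).and ih).of_eq fun _ => List.forall_mem_cons.symm
  obtain ⟨l, hl⟩ := exists_list_setOf_mem (Set.finite_univ (α := I))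
  exact (hlist l).of_eq fun _ => ⟨fun h i => h i (hl.symm.subset trivial), fun h i _ => h i⟩

theorem primrecPred_exists_finite {I : Type*} [Finite I] {p : α → I → Prop}
    (hp : ∀ i, PrimrecPred fun x => p x i) : PrimrecPred fun x => ∃ i, p x i :=
  (primrecPred_forall_finite fun i => (hp i).not).not.of_eq fun _ => by simp

theorem primrecPred_mem {f : α → β} {g : α → List β} (hf : Primrec f) (hg : Primrec g) :
    PrimrecPred fun x => f x ∈ g x :=
  (primrecPred_exists_mem (p := fun x y => y = f x) hg
    (Primrec.eq.comp snd (hf.comp fst))).of_eq fun _ => by simp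

theorem primrecPred_subset {f g : α → List β} (hf : Primrec f) (hg : Primrec g) :
    PrimrecPred fun x => f x ⊆ g x :=
  primrecPred_forall_mem hf (primrecPred_mem snd (hg.comp fst))

theorem primrec_list_singleton {f : α → β} (hf : Primrec f) : Primrec fun x => [f x] :=
  list_cons.comp hf (const [])

theorem primrec_filter {f : α → List β} {p : α → β → Prop} [∀ x, DecidablePred (p x)]
    (hf : Primrec f) (hp : PrimrecPred fun z : α × β => p z.1 z.2) :
    Primrec fun x => (f x).filter fun y => p x y :=
  ((PrimrecRel.listFilter (R := fun y x => p x y) (PrimrecRel.swap (r := p) hp)).comp hf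
    Primrec.id).of_eq fun _ => by simp

theorem primrec_apply_of_le {f : α → ℕ} {g : α → ℕ → σ} (hf : Primrec f) (N : ℕ)
    (hN : ∀ x, f x ≤ N) (hg : ∀ n, Primrec fun x => g x n) : Primrec fun x => g x (f x) := by
  have hmin (N) : Primrec fun x => g x (min (f x) N) := by
    induction N with
    | zero => exact (hg 0).of_eq fun _ => by simp
    | succ N ih =>
      refine (ite (nat_le.comp hf (const N)) ih (hg (N + 1))).of_eq fun x => ?_
      split_ifs with h
      · rw [min_eq_left h, min_eq_left (by omega)]
      · rw [min_eq_right (by omega)]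
  exact (hmin N).of_eq fun x => by rw [min_eq_left (hN x)]

theorem rePred_exists {p : α → β → Prop} (hp : PrimrecPred fun z : α × β => p z.1 z.2) :
    REPred fun x => ∃ y, p x y := by
  classical
  let f : α → ℕ → Option Unit := fun x n =>
    (Encodable.decode (α := β) n).bind fun y => if p x y then some () else none
  have hf : Primrec₂ f := Primrec.option_bind (Primrec.decode.comp snd)
    (Primrec.ite (hp.comp (Primrec.pair (fst.comp fst) snd)) (const _) (const _))
  refine (Partrec.rfindOpt hf.to_comp).dom_re.of_eq fun x => ?_
  rw [Nat.rfindOpt_dom]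
  constructor
  · rintro ⟨n, u, hu⟩
    obtain ⟨y, -, hy⟩ := Option.bind_eq_some_iff.1 hu
    split_ifs at hy with h
    exact ⟨y, h⟩
  · rintro ⟨y, hy⟩
    exact ⟨Encodable.encode y, (), by simp [f, hy]⟩

/-- The encoding behind the `Primcodable` instance of `TreeType`. -/
def treeTypeEquivProd : TreeType ≃ Bool × Bool where
  toFun α := (α.child, α.sibling)
  invFun p := ⟨p.1, p.2⟩

instance : Primcodable TreeType := .ofEquiv _ treeTypeEquivProd

/-- The encoding behind the `Primcodable` instance of `ListConf`. -/
def listConfEquivProd : ListConf ≃ TreeType × ℕ × ℕ × List (ℕ × ℕ) where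
  toFun r := (r.type, r.letter, r.datum, r.threads)
  invFun p := ⟨p.1, p.2.1, p.2.2.1, p.2.2.2⟩

instance : Primcodable ListConf := .ofEquiv _ listConfEquivProd

instance : Finite Dir := by
  refine Finite.of_surjective (fun b : Bool => if b then Dir.child else .sibling) ?_
  rintro (_ | _)
  exacts [⟨true, rfl⟩, ⟨false, rfl⟩]

theorem Instr.decode_min (i : ℕ × ℕ × ℕ) :
    Instr.decode (min i.1 11, i.2) = Instr.decode i := by
  obtain ⟨n, x⟩ := i
  obtain h | h := lt_or_ge n 11
  · rw [min_eq_left h.le]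
  · obtain ⟨n, rfl⟩ := Nat.exists_eq_add_of_le' h
    rw [min_eq_right h]
    rfl

theorem Instr.isMoving_decode {i : ℕ × ℕ × ℕ} :
    (Instr.decode i).IsMoving ↔ i.1 = 8 ∨ i.1 = 9 := by
  obtain ⟨n, x⟩ := i
  match n with
  | 0 | 1 | 2 | 3 | 4 | 5 | 6 | 7 | 8 | 9 | 10 | n + 11 => simp [Instr.decode, Instr.IsMoving]

theorem Instr.isSpread_decode {i : ℕ × ℕ × ℕ} : (Instr.decode i).IsSpread ↔ 11 ≤ i.1 := by
  obtain ⟨n, x⟩ := i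
  match n with
  | 0 | 1 | 2 | 3 | 4 | 5 | 6 | 7 | 8 | 9 | 10 | n + 11 => simp [Instr.decode, Instr.IsSpread]

theorem TypeTest.decode_min (n : ℕ) : TypeTest.decode (min n 3) = TypeTest.decode n := by
  obtain h | h := lt_or_ge n 3
  · rw [min_eq_left h.le]
  · obtain ⟨n, rfl⟩ := Nat.exists_eq_add_of_le' h
    rw [min_eq_right h]
    rfl

theorem primrec_of_primrec_decode {f : α → ℕ × ℕ × ℕ} {g : α → Instr ℕ ℕ → σ} (hf : Primrec f)
    (hg : ∀ n, Primrec fun x => g x (.decode (n, (f x).2))) :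
    Primrec fun x => g x (.decode (f x)) :=
  (primrec_apply_of_le (nat_min.comp (fst.comp hf) (const 11)) 11
    (fun _ => min_le_right _ _) hg).of_eq fun x => by rw [Instr.decode_min]

section Code

variable {c : α → Code} {M a k x q : α → ℕ} {αs : α → TreeType} {r s : α → ListConf}
  {Γ Δ : α → List (ℕ × ℕ)} {F : α → List ListConf}

theorem ListConf.primrec_type (hr : Primrec r) : Primrec fun z => (r z).type :=
  fst.comp ((of_equiv (e := listConfEquivProd)).comp hr)

theorem ListConf.primrec_letter (hr : Primrec r) : Primrec fun z => (r z).letter :=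
  fst.comp (snd.comp ((of_equiv (e := listConfEquivProd)).comp hr))

theorem ListConf.primrec_datum (hr : Primrec r) : Primrec fun z => (r z).datum :=
  fst.comp (snd.comp (snd.comp ((of_equiv (e := listConfEquivProd)).comp hr)))

theorem ListConf.primrec_threads (hr : Primrec r) : Primrec fun z => (r z).threads :=
  snd.comp (snd.comp (snd.comp ((of_equiv (e := listConfEquivProd)).comp hr)))

theorem ListConf.primrec_mk (hα : Primrec αs) (ha : Primrec a) (hx : Primrec x)
    (hΓ : Primrec Γ) : Primrec fun z => (⟨αs z, a z, x z, Γ z⟩ : ListConf) :=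
  (of_equiv_symm (e := listConfEquivProd)).comp (hα.pair (ha.pair (hx.pair hΓ)))

theorem TreeType.primrecPred_has (hα : Primrec αs) (dir : Dir) :
    PrimrecPred fun z => (αs z).has dir = true :=
  Primrec.eq.comp ((dom_finite fun α : TreeType => α.has dir).comp hα) (const true)

theorem TypeTest.primrecPred_holds_decode (hq : Primrec q) (hα : Primrec αs) :
    PrimrecPred fun z => (TypeTest.decode (q z)).Holds (αs z) := by
  classical
  let g : ℕ → TreeType → Bool := fun n α => decide ((TypeTest.decode n).Holds α)
  have h : Primrec fun z => g (min (q z) 3) (αs z) :=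
    primrec_apply_of_le (g := fun z n => g n (αs z)) (nat_min.comp hq (const 3)) 3
      (fun _ => min_le_right _ _) fun n => (dom_finite (g n)).comp hα
  exact (Primrec.eq.comp h (const true)).of_eq fun z => by simp [g, TypeTest.decode_min]

theorem primrec_instrCode (hc : Primrec c) (hq : Primrec q) :
    Primrec fun z => (c z).2.2.getD (q z) (4, 0, 0) :=
  (list_getD (4, 0, 0)).comp (snd.comp (snd.comp hc)) hq

theorem primrecPred_isMoving (hc : Primrec c) (hq : Primrec q) :
    PrimrecPred fun z => ((c z).automaton.δ (q z)).IsMoving := by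
  have hop := fst.comp (primrec_instrCode hc hq)
  exact ((Primrec.eq.comp hop (const 8)).or (Primrec.eq.comp hop (const 9))).of_eq fun _ =>
    Instr.isMoving_decode.symm

theorem primrecPred_isSpread (hc : Primrec c) (hq : Primrec q) :
    PrimrecPred fun z => ((c z).automaton.δ (q z)).IsSpread :=
  (nat_le.comp (const 11) (fst.comp (primrec_instrCode hc hq))).of_eq fun _ =>
    Instr.isSpread_decode.symm

theorem primrecPred_forall_isMoving (hc : Primrec c) (hΓ : Primrec Γ) :
    PrimrecPred fun z => ∀ t ∈ Γ z, ((c z).automaton.δ t.1).IsMoving :=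
  primrecPred_forall_mem hΓ (primrecPred_isMoving (hc.comp fst) (fst.comp snd))

theorem primrec_spreadList {q' : α → ℕ} (hq : Primrec q) (hq' : Primrec q') (hΔ : Primrec Δ) :
    Primrec fun z => spreadList (q z) (q' z) (Δ z) :=
  list_map (primrec_filter hΔ (Primrec.eq.comp (fst.comp snd) (hq.comp fst)))
    ((hq'.comp fst).pair (snd.comp snd))

theorem primrec_target_decode {i : α → ℕ × ℕ × ℕ} (hi : Primrec i) (dir : Dir) :
    Primrec fun z => (Instr.decode (i z)).target dir :=
  primrec_of_primrec_decode (g := fun _ φ => φ.target dir) hi fun n => by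
    have hq := option_some.comp (fst.comp (snd.comp hi))
    cases dir
    · match n with
      | 8 => exact hq
      | 0 | 1 | 2 | 3 | 4 | 5 | 6 | 7 | 9 | 10 | _ + 11 => exact const none
    · match n with
      | 9 => exact hq
      | 0 | 1 | 2 | 3 | 4 | 5 | 6 | 7 | 8 | 10 | _ + 11 => exact const none

theorem primrec_moveList (hc : Primrec c) (hΓ : Primrec Γ) (dir : Dir) :
    Primrec fun z => moveList (c z).automaton dir (Γ z) :=
  listFilterMap hΓ <| option_map
    (primrec_target_decode (primrec_instrCode (hc.comp fst) (fst.comp snd)) dir)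
    (snd.pair (snd.comp (snd.comp fst)))

theorem primrec_replacements (hc : Primrec c) (hM : Primrec M) (hr : Primrec r) (hx : Primrec x)
    (hΔ : Primrec Δ) {i : α → ℕ × ℕ × ℕ} (hi : Primrec i) :
    Primrec fun z => replacements (c z).automaton (M z) (r z) (x z) (Δ z) (.decode (i z)) := by
  classical
  have hq : Primrec fun z => (i z).2.1 := fst.comp (snd.comp hi)
  have hq' : Primrec fun z => (i z).2.2 := snd.comp (snd.comp hi)
  have hyes : Primrec fun _ : α => ([[]] : List (List (ℕ × ℕ))) := const _
  have hno : Primrec fun _ : α => ([] : List (List (ℕ × ℕ))) := const _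
  have hletter := Primrec.eq.comp hq (ListConf.primrec_letter hr)
  have hdatum := Primrec.eq.comp (ListConf.primrec_datum hr) hx
  have hthread := primrec_list_singleton (hq.pair hx)
  have hthread' := primrec_list_singleton (hq'.pair hx)
  refine primrec_of_primrec_decode
    (g := fun z => replacements (c z).automaton (M z) (r z) (x z) (Δ z)) hi fun n => ?_
  match n with
  | 0 => exact ite hletter hyes hno
  | 1 => exact ite hletter hno hyes
  | 2 => exact ite (TypeTest.primrecPred_holds_decode hq (ListConf.primrec_type hr)) hyes hno
  | 3 => exact primrec_list_singleton (primrec_list_singleton (hq.pair (ListConf.primrec_datum hr)))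
  | 4 => exact ite hdatum hyes hno
  | 5 => exact ite hdatum hno hyes
  | 6 => exact primrec_list_singleton (list_cons.comp (hq.pair hx) hthread')
  | 7 => exact list_cons.comp hthread (primrec_list_singleton hthread')
  | 8 | 9 => exact hno
  | 10 =>
    exact list_map (list_range.comp hM) (primrec_list_singleton ((hq.comp fst).pair snd))
  | n + 11 =>
    have hready : PrimrecPred fun z => ∀ s ∈ Δ z, ((c z).automaton.δ s.1).IsSpread ∨
        ((c z).automaton.δ s.1).IsMoving :=
      primrecPred_forall_mem hΔ <| (primrecPred_isSpread (hc.comp fst) (fst.comp snd)).or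
        (primrecPred_isMoving (hc.comp fst) (fst.comp snd))
    exact ite hready (primrec_list_singleton (primrec_spreadList hq hq' hΔ)) hno

theorem primrec_epsSucc (hc : Primrec c) (hM : Primrec M) (hr : Primrec r) :
    Primrec fun z => epsSucc (c z).automaton (M z) (r z) := by
  have hΔ : Primrec fun z : α × ℕ × ℕ => (r z.1).threads.filter fun s => s ≠ z.2 :=
    primrec_filter (ListConf.primrec_threads (hr.comp fst))
      (Primrec.eq.comp snd (snd.comp fst)).not
  have hrepl := primrec_replacements (hc.comp fst) (hM.comp fst) (hr.comp fst) (snd.comp snd) hΔ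
    (primrec_instrCode (hc.comp fst) (fst.comp snd))
  have hr' : Primrec fun z : (α × ℕ × ℕ) × List (ℕ × ℕ) => r z.1.1 := hr.comp (fst.comp fst)
  exact list_flatMap (ListConf.primrec_threads hr) <| list_map hrepl <|
    ListConf.primrec_mk (ListConf.primrec_type hr') (ListConf.primrec_letter hr')
      (ListConf.primrec_datum hr') (list_append.comp snd (hΔ.comp fst))

theorem ListConf.primrecPred_le (hr : Primrec r) (hs : Primrec s) :
    PrimrecPred fun z => (r z).Le (s z) :=
  (Primrec.eq.comp (ListConf.primrec_type hr) (ListConf.primrec_type hs)).and <|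
    (Primrec.eq.comp (ListConf.primrec_letter hr) (ListConf.primrec_letter hs)).and <|
      (Primrec.eq.comp (ListConf.primrec_datum hr) (ListConf.primrec_datum hs)).and <|
        primrecPred_subset (ListConf.primrec_threads hr) (ListConf.primrec_threads hs)

theorem primrecPred_justified {C : α → List (ℕ × ListConf)} {n : α → ℕ} (hc : Primrec c)
    (hk : Primrec k) (hC : Primrec C) (hn : Primrec n) (hr : Primrec r) :
    PrimrecPred fun z => Justified (c z).automaton (k z) (C z) (n z) (r z) := by
  have hα := ListConf.primrec_type hr
  have hΓ := ListConf.primrec_threads hr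
  refine (Primrec.eq.comp hΓ (const [])).or (.or ?_ (.and ?_ (.and ?_ ?_)))
  · exact primrecPred_exists_mem (primrec_epsSucc hc hn hr) <|
      primrecPred_exists_mem (hC.comp fst) <|
        (nat_lt.comp (fst.comp snd) (hn.comp (fst.comp fst))).and <|
          ListConf.primrecPred_le (snd.comp fst) (snd.comp snd)
  · exact primrecPred_forall_isMoving hc hΓ
  · exact primrecPred_exists_finite (TreeType.primrecPred_has hα)
  · refine primrecPred_forall_finite fun dir => primrecPred_imp (TreeType.primrecPred_has hα dir) ?_
    exact primrecPred_exists_mem hC <|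
      (nat_lt.comp (fst.comp snd) (hn.comp fst)).and <|
        (nat_lt.comp (ListConf.primrec_letter (snd.comp snd)) (hk.comp fst)).and <|
          primrecPred_subset ((primrec_moveList hc hΓ dir).comp fst)
            (ListConf.primrec_threads (snd.comp snd))

theorem primrecPred_covered (hF : Primrec F) (hr : Primrec r) :
    PrimrecPred fun z => Covered (F z) (r z) :=
  primrecPred_exists_mem hF (ListConf.primrecPred_le snd (hr.comp fst))

theorem ListConf.primrecPred_hasSpare (hM : Primrec M) (hr : Primrec r) :
    PrimrecPred fun z => (r z).HasSpare (M z) := by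
  have hd := ListConf.primrec_datum hr
  have hΓ := ListConf.primrec_threads hr
  refine (nat_lt.comp hd hM).and (.and ?_ ?_)
  · exact primrecPred_forall_mem hΓ (nat_lt.comp (snd.comp snd) (hM.comp fst))
  · exact primrecPred_exists_lt hM <| (Primrec.eq.comp snd (hd.comp fst)).not.and <|
      primrecPred_forall_mem (hΓ.comp fst) (Primrec.eq.comp (snd.comp snd) (snd.comp fst)).not

theorem primrecPred_lossClosed (hc : Primrec c) (hk : Primrec k) (hM : Primrec M) (hF : Primrec F)
    (hr : Primrec r) :
    PrimrecPred fun z => LossClosed (c z).automaton (k z) (M z) (F z) (r z) := by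
  have hα := ListConf.primrec_type hr
  have hΓ := ListConf.primrec_threads hr
  refine (Primrec.eq.comp hΓ (const [])).not.and
    ((ListConf.primrecPred_hasSpare hM hr).and (.and ?_ ?_))
  · exact primrecPred_forall_mem (primrec_epsSucc hc hM hr)
      (primrecPred_covered (hF.comp fst) snd)
  · refine primrecPred_imp (primrecPred_forall_isMoving hc hΓ) <|
      primrecPred_imp (primrecPred_exists_finite (TreeType.primrecPred_has hα)) <|
        primrecPred_exists_finite fun dir => (TreeType.primrecPred_has hα dir).and <|
          primrecPred_forall_finite fun β => ?_
    refine primrecPred_forall_lt hk (primrecPred_forall_lt (hM.comp fst) ?_)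
    exact primrecPred_covered (hF.comp (fst.comp fst)) <|
      ListConf.primrec_mk (const β) (snd.comp fst) snd
        ((primrec_moveList hc hΓ dir).comp (fst.comp fst))

end Code

theorem primrecPred_isWinCert :
    PrimrecPred fun z : Code × List (ℕ × ListConf) => IsWinCert z.1.automaton z.1.1 z.2 := by
  refine .and (primrecPred_forall_mem snd ?_) (primrecPred_exists_mem snd ?_)
  · exact primrecPred_justified (fst.comp fst) (fst.comp (fst.comp fst)) (snd.comp fst)
      (fst.comp snd) (snd.comp snd)
  · have hc : Primrec fun z : (Code × List (ℕ × ListConf)) × ℕ × ListConf => z.1.1 := fst.comp fst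
    have hp : Primrec fun z : (Code × List (ℕ × ListConf)) × ℕ × ListConf => z.2.2 := snd.comp snd
    have hsib : Primrec TreeType.sibling := dom_finite _
    exact (Primrec.eq.comp (hsib.comp (ListConf.primrec_type hp)) (const false)).and <|
      (nat_lt.comp (ListConf.primrec_letter hp) (fst.comp hc)).and <|
        primrecPred_mem ((fst.comp (snd.comp hc)).pair (ListConf.primrec_datum hp))
          (ListConf.primrec_threads hp)

theorem primrecPred_isLossCert : PrimrecPred fun z : Code × ℕ × List ListConf =>
    IsLossCert z.1.automaton z.1.1 z.2.1 z.2.2 := by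
  refine .and (primrecPred_forall_mem (snd.comp snd) ?_) (primrecPred_forall_finite fun c => ?_)
  · exact primrecPred_lossClosed (fst.comp fst) (fst.comp (fst.comp fst))
      (fst.comp (snd.comp fst)) (snd.comp (snd.comp fst)) snd
  · refine primrecPred_forall_lt (fst.comp fst) ?_
    have hinit : Primrec fun z : (Code × ℕ × List ListConf) × ℕ => [(z.1.1.2.1, 0)] :=
      primrec_list_singleton ((fst.comp (snd.comp (fst.comp fst))).pair (const 0))
    have hF : Primrec fun z : (Code × ℕ × List ListConf) × ℕ => z.1.2.2 :=
      snd.comp (snd.comp fst)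
    have hstart : Primrec fun z : (Code × ℕ × List ListConf) × ℕ =>
        (⟨⟨c, false⟩, z.2, 0, [(z.1.1.2.1, 0)]⟩ : ListConf) :=
      ListConf.primrec_mk (const _) snd (const 0) hinit
    exact primrecPred_covered hF hstart

theorem computablePred_codeNonempty : ComputablePred CodeNonempty := by
  rw [ComputablePred.computable_iff_re_compl_re']
  have hwin : REPred CodeNonempty :=
    (rePred_exists (p := fun c : Code => IsWinCert c.automaton c.1) primrecPred_isWinCert).of_eq
      fun _ => hasWinningStart_iff_exists_isWinCert.symm
  have hloss := rePred_exists
    (p := fun (c : Code) (z : ℕ × List ListConf) => IsLossCert c.automaton c.1 z.1 z.2)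
    primrecPred_isLossCert
  refine ⟨hwin, hloss.of_eq fun c => ?_⟩
  obtain ⟨m, hm⟩ := c.exists_statesLT
  exact Prod.exists.trans (not_hasWinningStart_iff_exists_isLossCert hm).symm

end Decidability

end ATRA

theorem mainTheorem2 (D : Type u) [Infinite D] :
    ∃ isEmpty : ATRA.Code → Bool, Computable isEmpty ∧
      ∀ (Alph : Type v) (Q : Type w) (k m : ℕ) (eA : Alph ≃ Fin k) (eQ : Q ≃ Fin m)
        (A : ATRA.Automaton Alph Q),
        isEmpty (A.code eA eQ) = true ↔ A.language D = ∅ := by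
  classical
  refine ⟨fun c => decide (¬ ATRA.CodeNonempty c),
    ATRA.computablePred_codeNonempty.not.decide, fun Alph Q k m eA eQ A => ?_⟩
  rw [decide_eq_true_iff, ← ATRA.language_nonempty_iff_codeNonempty eA eQ A D,
    Set.not_nonempty_iff_eq_empty]
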